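/- Let $h:[0,\infty)\to\mathbb R$ be convex with $h(0)=0$, $h(x)>0$ for $x>0$, and $h(x)/x^{1+\eta_0}\to\infty$ as $x\to\infty$ for some $\eta_0>0$; let $h^{-1}$ be its inverse on $[0,\infty)$, and let $B>0$. For observations $X_1,\dots,X_n\in\mathbb R$ ($n\ge 1$) let $F_n$ be their empirical distribution, and for $\gamma>0$, $\mu^\star\in\mathbb R$ let the boundary crossing probability be $$[\mathrm{BCP}]=\mathbb P_w\Big(\exists x\ge\mu^\star:\ \sum_{i=1}^n w_iX_i+w_{n+1}x\ge\mu^\star,\ \sum_{i=1}^n w_ih(|X_i-\mu^\star|)+w_{n+1}\big(h(|x-\mu^\star|)-\gamma\big)\le B\Big),$$ where $w=(w_1,\dots,w_{n+1})\sim\mathrm{Dir}(1,\dots,1)$ is uniform on the probability simplex and the observations are fixed. For $\eta\ge 0$ let $$\Lambda^\star_{\eta,\gamma}(F,\mu)=\max_{(\alpha,\beta)\in\mathcal R^{\eta,\gamma}}\mathbb E_F\big[\log\big(1-\alpha(X-\mu)-\beta(B-h(|X-\mu|))\big)\big],$$ $$\mathcal R^{\eta,\gamma}=\{(\alpha,\beta)\in[0,\infty)^2:\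 \forall x\in\mathbb R,\ 1-\alpha(x+\eta-\mu)-\beta(B+\gamma-h(|x-\mu|))\ge 0\},$$ and $\Lambda^\star_\gamma=\Lambda^\star_{0,\gamma}$. For $F=F_n$ this maximum is attained. Moreover, the following hold. (1) Upper bound. For every $\gamma>0$ there is a mapping $C$ of $(F,\eta)$, jointly continuous in $F$ (on the distributions with finite mean, with the Wasserstein metric $W_1$) and $\eta>0$, and with $C(F,\eta)$ of exact order $\eta^{-2}$ as $\eta\downarrow 0$ for each $F$, such that for all $\eta>0$, $n\ge1$, all observations and all $\mu^\star>\mathbb E_{F_n}[X]$, $$[\mathrm{BCP}]\le C(F_n,\eta)\,e^{-n\Lambda^\star_{\eta,\gamma}(F_n,\mu^\star)}.$$ (2) Lower bound, large $n$. For every $\delta>0$ there is $c_\delta>0$, and for every $\gamma>0$ there is $n_{\delta,\gamma}\in\mathbb N$, such that for all $n\ge \max(1,n_{\delta,\gamma})$, all observations and all $\mu^\star>\mathbb E_{F_n}[X]$, $$[\mathrm{BCP}]\ge c_\delta\,e^{-n(\Lambda^\star_\gamma(F_n,\mu^\star)+\delta)}.$$ (3) Lower bound, small $n$. For every $\gamma>0$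 and every $n\ge1$ (in particular every $1\le n\le n_{\delta,\gamma}$), all observations and all $\mu^\star>\mathbb E_{F_n}[X]$ with $|\mu^\star|<h^{-1}(B)$ and $\mathbb E_{F_n}[h(|X-\mu^\star|)]\le B$, $$[\mathrm{BCP}]\ge e^{-n\log(nC_{B,\mu^\star})},\qquad C_{B,\mu}=\max\left\{\frac{3h^{-1}(B)-\mu}{h^{-1}(B)-\mu},\ \frac{B}{B-h\big(\frac{h^{-1}(B)-\mu}{2}\big)}\right\}.$$ -/

import Mathlib

open MeasureTheory Filter Topology Asymptotics
open scoped ENNReal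

noncomputable section

namespace HNPTS

/-- The standing assumptions on the moment function `h` (only its values on `[0, ∞)` matter):
it is convex, `h 0 = 0`, positive on `(0, ∞)`, and `h x / x ^ (1 + η₀) → ∞` for some `η₀ > 0`. -/
structure IsMomentFunction (h : ℝ → ℝ) : Prop where
  convex : ConvexOn ℝ (Set.Ici 0) h
  map_zero : h 0 = 0
  pos : ∀ x, 0 < x → 0 < h x
  growth : ∃ η₀ : ℝ, 0 < η₀ ∧ Tendsto (fun x : ℝ => h x / x ^ (1 + η₀)) atTop atTop

/-- The inverse `h⁻¹` of `h` on `[0, ∞)`. -/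
def hInv (h : ℝ → ℝ) (t : ℝ) : ℝ := Function.invFunOn h (Set.Ici 0) t

/-- The empirical distribution `F_n` of the observations `X₁, …, X_n`. -/
def empirical {n : ℕ} (X : Fin n → ℝ) : Measure ℝ :=
  (n : ℝ≥0∞)⁻¹ • ∑ i, Measure.dirac (X i)

/-- The solid simplex `{u ∈ ℝⁿ : u ≥ 0, ∑ uᵢ ≤ 1}`, which parametrizes the probability simplex
of `ℝⁿ⁺¹` by its first `n` coordinates. -/
def solidSimplex (n : ℕ) : Set (Fin n → ℝ) :=
  {u | (∀ i, 0 ≤ u i) ∧ ∑ i, u i ≤ 1}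

/-- The Dirichlet distribution `Dir(1, …, 1)` with `n + 1` parameters, i.e. the uniform
distribution on the probability simplex of `ℝⁿ⁺¹`: the first `n` coordinates are uniform on the
solid simplex, and the last one is one minus their sum. -/
def dirichletOne (n : ℕ) : Measure (Fin (n + 1) → ℝ) :=
  (ProbabilityTheory.cond volume (solidSimplex n)).map
    (fun u => Fin.snoc (α := fun _ => ℝ) u (1 - ∑ i, u i))

/-- The boundary crossing probability: the probability, over `w ~ Dir(1, …, 1)`, that there is an
additional support point `x ≥ μ` such that `∑_{i ≤ n} wᵢ Xᵢ + w_{n+1} x ≥ μ` and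
`∑_{i ≤ n} wᵢ h(|Xᵢ - μ|) + w_{n+1} (h(|x - μ|) - γ) ≤ B`. -/
def bcp (h : ℝ → ℝ) (B γ μ : ℝ) {n : ℕ} (X : Fin n → ℝ) : ℝ :=
  (dirichletOne n).real {w | ∃ x : ℝ, μ ≤ x ∧
    μ ≤ (∑ i : Fin n, w i.castSucc * X i) + w (Fin.last n) * x ∧
    (∑ i : Fin n, w i.castSucc * h |X i - μ|) + w (Fin.last n) * (h |x - μ| - γ) ≤ B}

/-- The dual feasible set `R₂^{η,γ}`. -/
def dualSet (h : ℝ → ℝ) (B η γ μ : ℝ) : Set (ℝ × ℝ) :=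
  {p | 0 ≤ p.1 ∧ 0 ≤ p.2 ∧
    ∀ x : ℝ, 0 ≤ 1 - p.1 * (x + η - μ) - p.2 * (B + γ - h |x - μ|)}

/-- The dual objective `E_F[log(1 - α (X - μ) - β (B - h(|X - μ|)))]`. -/
def dualObjective (h : ℝ → ℝ) (B : ℝ) (F : Measure ℝ) (μ : ℝ) (p : ℝ × ℝ) : ℝ :=
  ∫ x, Real.log (1 - p.1 * (x - μ) - p.2 * (B - h |x - μ|)) ∂F

/-- `Λ*_{η,γ}(F, μ)`, the maximum of the dual objective over `R₂^{η,γ}`;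
`Λ*_γ` is the case `η = 0`. -/
def lambdaStar (h : ℝ → ℝ) (B η γ : ℝ) (F : Measure ℝ) (μ : ℝ) : ℝ :=
  sSup (dualObjective h B F μ '' dualSet h B η γ μ)

/-- Probability distributions on `ℝ` with a finite first moment. -/
def FiniteMean (F : Measure ℝ) : Prop :=
  IsProbabilityMeasure F ∧ Integrable (fun x : ℝ => x) F

/-- The (order one) Wasserstein distance: the infimum of `∫ |x - y| dπ` over all couplings `π`. -/
def wasserstein (F G : Measure ℝ) : ℝ≥0∞ :=
  ⨅ (π : Measure (ℝ × ℝ)) (_ : π.map Prod.fst = F) (_ : π.map Prod.snd = G),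
    ∫⁻ z, edist z.1 z.2 ∂π

/-- Joint continuity of `C(F, η)` on (distributions with finite mean, Wasserstein) `× (0, ∞)`. -/
def JointlyContinuous (C : Measure ℝ → ℝ → ℝ) : Prop :=
  ∀ F, FiniteMean F → ∀ η : ℝ, 0 < η → ∀ ε : ℝ, 0 < ε → ∃ ρ : ℝ, 0 < ρ ∧
    ∀ G, FiniteMean G → ∀ η' : ℝ, 0 < η' →
      wasserstein F G < ENNReal.ofReal ρ → |η' - η| < ρ → |C G η' - C F η| < ε

/-- The constant `C_{B,μ}`. -/
def constCB (h : ℝ → ℝ) (B μ : ℝ) : ℝ :=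
  max ((3 * hInv h B - μ) / (hInv h B - μ)) (B / (B - h ((hInv h B - μ) / 2)))

end HNPTS

end

/-! Write `Y i = X i - μ`. The crossing probability is the proportion of the solid simplex filled by
the weights `u` that satisfy two constraints for some extra point `y ≥ 0`. All three bounds compare
Lebesgue volumes through diagonal maps.

Upper bound (`bcp_le_exp_lambdaStar`): a dual optimizer gives factors `D i = 1 - α Y i - β (B - h |Y
i|) > 0`, and weak duality gives `∑ D i * u i ≤ 1` at every crossing point. So the crossing set lies
in the preimage of the simplex under `diag D`, whose relative volume is `∏ (D i)⁻¹ = exp (-n Λ)`.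

Lower bound for large `n` (`exists_le_bcp`): strong duality, by Hahn-Banach separation, provides a
crossing point with `∏ n * u i ≥ exp (-n (Λ + δ))` (`exists_mem_crossingSet`). Contracting it
towards the last vertex creates slack, so its coordinates may be multiplied by any `g ≥ 0` for which
a few weighted sums of `g - 1` are small (`perturbation_mem`). Under the product exponential law
such `g` have probability bounded below independently of `n` and of the observations
(`exists_le_expLawPi`). Their density is at most about `exp (-n)`, so they fill a volume of about
`exp n`, up to small exponential factors, whereas the simplex has volume at most `exp n / n ^ n`.

Lower bound for every `n` (`pow_le_bcp`): the simplex shrunk by `1 / (n C)` consists of crossing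
points. -/

namespace HNPTS

/-! ### Elementary properties of moment functions -/

namespace IsMomentFunction

variable {h : ℝ → ℝ}

lemma nonneg (hh : IsMomentFunction h) {x : ℝ} (hx : 0 ≤ x) : 0 ≤ h x := by
  rcases hx.eq_or_lt with rfl | hx
  · exact hh.map_zero.ge
  · exact (hh.pos x hx).le

lemma map_mul_le (hh : IsMomentFunction h) {t x : ℝ} (ht : 0 ≤ t) (ht' : t ≤ 1) (hx : 0 ≤ x) :
    h (t * x) ≤ t * h x := by
  have := hh.convex.2 (Set.mem_Ici.2 hx) (Set.mem_Ici.2 le_rfl) ht (sub_nonneg.2 ht') (by ring)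
  simpa [hh.map_zero] using this

lemma strictMonoOn (hh : IsMomentFunction h) : StrictMonoOn h (Set.Ici 0) := by
  intro x hx y hy hxy
  have hx : 0 ≤ x := hx
  have hy0 : 0 < y := hx.trans_lt hxy
  have h1 := hh.map_mul_le (t := x / y) (by positivity) ((div_le_one hy0).2 hxy.le) hy0.le
  rw [div_mul_cancel₀ _ hy0.ne'] at h1
  refine h1.trans_lt ?_
  have := hh.pos y hy0
  have h2 := (div_lt_one hy0).2 hxy
  nlinarith

/-- Beyond `1`, the slope of the chord from the origin is at least `h 1`. This lets a moment bound
control first-order terms. -/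
lemma le_one_add_div (hh : IsMomentFunction h) {x : ℝ} (hx : 0 ≤ x) : x ≤ 1 + h x / h 1 := by
  have h1 := hh.pos 1 one_pos
  have h0 := hh.nonneg hx
  rcases le_total x 1 with hx1 | hx1
  · have : 0 ≤ h x / h 1 := by positivity
    linarith
  · have hx0 : 0 < x := by linarith
    have h2 := hh.map_mul_le (t := 1 / x) (by positivity) ((div_le_one hx0).2 hx1) hx
    rw [one_div, inv_mul_cancel₀ hx0.ne', ← div_eq_inv_mul, le_div_iff₀ hx0] at h2
    have : x ≤ h x / h 1 := by rw [le_div_iff₀ h1]; linarith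
    linarith

lemma exists_pos_le (hh : IsMomentFunction h) {ε : ℝ} (hε : 0 < ε) : ∃ y, 0 < y ∧ h y ≤ ε := by
  have h1 := hh.pos 1 one_pos
  refine ⟨min 1 (ε / h 1), by positivity, ?_⟩
  have h2 := hh.map_mul_le (t := min 1 (ε / h 1)) (by positivity) (min_le_left _ _) zero_le_one
  rw [mul_one] at h2
  refine h2.trans ?_
  calc min 1 (ε / h 1) * h 1 ≤ ε / h 1 * h 1 := by gcongr; exact min_le_right _ _
    _ = ε := div_mul_cancel₀ _ h1.ne'

lemma exists_eq (hh : IsMomentFunction h) {t : ℝ} (ht : 0 < t) : ∃ x ∈ Set.Ici (0 : ℝ), h x = t := by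
  obtain ⟨y, hy, hyt⟩ := hh.exists_pos_le ht
  have h1 := hh.pos 1 one_pos
  set M := 1 + t / h 1 with hM
  have hM0 : 0 ≤ M := by positivity
  have htM : t ≤ h M := by
    have h3 := hh.map_mul_le (t := 1 / M) (x := M) (by positivity)
      ((div_le_one (by positivity)).2 (by rw [hM]; linarith [div_pos ht h1])) hM0
    rw [one_div, inv_mul_cancel₀ (by positivity), ← div_eq_inv_mul, le_div_iff₀ (by positivity),
      hM, mul_add, mul_div_cancel₀ _ h1.ne'] at h3
    linarith
  have hyM : y ≤ M := by
    by_contra! hlt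
    have := hh.strictMonoOn hM0 hy.le hlt
    linarith
  -- Convexity gives continuity on the interior of the domain, hence an interval starting at `y >
  -- 0`.
  have hc : ContinuousOn h (Set.Icc y M) := by
    have := hh.convex.continuousOn_interior
    rw [interior_Ici] at this
    exact this.mono fun z hz => hy.trans_le hz.1
  obtain ⟨x, hx, hxt⟩ := intermediate_value_Icc hyM hc ⟨hyt, htM⟩
  exact ⟨x, hy.le.trans hx.1, hxt⟩

lemma apply_hInv (hh : IsMomentFunction h) {t : ℝ} (ht : 0 < t) : h (hInv h t) = t :=
  Function.invFunOn_eq (hh.exists_eq ht)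

end IsMomentFunction

/-! ### Crossing probabilities as ratios of volumes -/

lemma integral_empirical {n : ℕ} (X : Fin n → ℝ) (f : ℝ → ℝ) :
    ∫ x, f x ∂(empirical X) = (n : ℝ)⁻¹ * ∑ i, f (X i) := by
  rw [empirical, integral_smul_measure, integral_finsetSum_measure]
  · simp
  · intro i _
    exact integrable_dirac (by simp)

/-- The event of a boundary crossing, in terms of the first `n` weights and the centred
observations. -/
def crossingSet (h : ℝ → ℝ) (B γ : ℝ) {n : ℕ} (Y : Fin n → ℝ) : Set (Fin n → ℝ) :=
  {u | ∃ y : ℝ, 0 ≤ y ∧ 0 ≤ ∑ i, u i * Y i + (1 - ∑ i, u i) * y ∧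
    ∑ i, u i * (h |Y i| - B) + (1 - ∑ i, u i) * (h y - γ - B) ≤ 0}

/-- The weights on the probability simplex with prescribed first `n` coordinates. -/
def simplexEmbedding {n : ℕ} (u : Fin n → ℝ) : Fin (n + 1) → ℝ :=
  Fin.snoc (α := fun _ => ℝ) u (1 - ∑ i, u i)

lemma measurable_simplexEmbedding {n : ℕ} : Measurable (simplexEmbedding (n := n)) := by
  refine measurable_pi_lambda _ fun i => ?_
  refine Fin.lastCases ?_ (fun j => ?_) i
  · simp only [simplexEmbedding, Fin.snoc_last]; fun_prop
  · simp only [simplexEmbedding, Fin.snoc_castSucc]; fun_prop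

/-- Since the weights sum to one, `μ` and `B` can be subtracted inside the averages; then `y = x -
μ`. -/
lemma preimage_crossing_event (h : ℝ → ℝ) (B γ μ : ℝ) {n : ℕ} (X : Fin n → ℝ) :
    simplexEmbedding ⁻¹' {w | ∃ x : ℝ, μ ≤ x ∧
      μ ≤ (∑ i : Fin n, w i.castSucc * X i) + w (Fin.last n) * x ∧
      (∑ i : Fin n, w i.castSucc * h |X i - μ|) + w (Fin.last n) * (h |x - μ| - γ) ≤ B} =
    crossingSet h B γ fun i => X i - μ := by
  ext u
  simp only [simplexEmbedding, crossingSet, Set.mem_preimage, Set.mem_ofPred_eq, Fin.snoc_castSucc,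
    Fin.snoc_last, mul_sub, Finset.sum_sub_distrib, ← Finset.sum_mul]
  constructor
  · rintro ⟨x, hx, h1, h2⟩
    refine ⟨x - μ, sub_nonneg.2 hx, by linarith, ?_⟩
    rw [abs_of_nonneg (sub_nonneg.2 hx)] at h2
    linarith
  · rintro ⟨y, hy, h1, h2⟩
    refine ⟨μ + y, by linarith, by linarith, ?_⟩
    rw [add_sub_cancel_left, abs_of_nonneg hy]
    linarith

lemma measurableSet_solidSimplex (n : ℕ) : MeasurableSet (solidSimplex n) := by
  have : IsClosed (solidSimplex n) := by
    simp only [solidSimplex, Set.ofPred_and, Set.ofPred_forall]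
    exact (isClosed_iInter fun i => isClosed_le continuous_const (continuous_apply i)).inter
      (isClosed_le (by fun_prop) continuous_const)
  exact this.measurableSet

lemma volume_solidSimplex_ne_top (n : ℕ) : volume (solidSimplex n) ≠ ∞ := by
  refine ((Metric.isBounded_Icc (0 : Fin n → ℝ) 1).subset ?_).measure_lt_top.ne
  intro u hu
  exact ⟨hu.1, fun i => (Finset.single_le_sum (fun j _ => hu.1 j) (Finset.mem_univ i)).trans hu.2⟩

lemma volume_solidSimplex_ne_zero (n : ℕ) : volume (solidSimplex n) ≠ 0 := by
  have hpos : 0 < volume (Set.univ.pi fun _ : Fin n => Set.Icc (0 : ℝ) (1 / (n + 1))) := by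
    rw [volume_pi_pi]
    refine pos_iff_ne_zero.2 (Finset.prod_ne_zero_iff.2 fun i _ => ?_)
    simp only [Real.volume_Icc, sub_zero, ne_eq, ENNReal.ofReal_eq_zero, not_le]
    positivity
  refine (hpos.trans_le (measure_mono fun u hu => ?_)).ne'
  simp only [Set.mem_pi, Set.mem_univ, true_implies, Set.mem_Icc] at hu
  refine ⟨fun i => (hu i).1, ?_⟩
  calc ∑ i, u i ≤ ∑ _i : Fin n, 1 / ((n : ℝ) + 1) := Finset.sum_le_sum fun i _ => (hu i).2
    _ = n / (n + 1) := by simp [div_eq_mul_inv]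
    _ ≤ 1 := by rw [div_le_one (by positivity)]; linarith

lemma dirichletOne_eq_map (n : ℕ) : dirichletOne n =
    (ProbabilityTheory.cond volume (solidSimplex n)).map simplexEmbedding := rfl

lemma isProbabilityMeasure_dirichletOne (n : ℕ) : IsProbabilityMeasure (dirichletOne n) := by
  have := ProbabilityTheory.cond_isProbabilityMeasure_of_finite (volume_solidSimplex_ne_zero n)
    (volume_solidSimplex_ne_top n)
  rw [dirichletOne_eq_map]
  exact Measure.isProbabilityMeasure_map measurable_simplexEmbedding.aemeasurable

/-- A subset of the crossing set bounds the crossing probability from below. -/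
lemma le_bcp {h : ℝ → ℝ} {B γ μ : ℝ} {n : ℕ} {X : Fin n → ℝ} {A : Set (Fin n → ℝ)}
    (hA : A ⊆ crossingSet h B γ fun i => X i - μ) (hA' : A ⊆ solidSimplex n) {r : ℝ}
    (hr : ENNReal.ofReal r * volume (solidSimplex n) ≤ volume A) : r ≤ bcp h B γ μ X := by
  have := isProbabilityMeasure_dirichletOne n
  rw [bcp, measureReal_def, ← ENNReal.ofReal_le_iff_le_toReal (measure_ne_top _ _),
    dirichletOne_eq_map]
  refine le_trans ?_ (Measure.le_map_apply measurable_simplexEmbedding.aemeasurable _)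
  rw [preimage_crossing_event, ProbabilityTheory.cond_apply (measurableSet_solidSimplex n)]
  rw [← ENNReal.div_eq_inv_mul,
    ENNReal.le_div_iff_mul_le (.inl (volume_solidSimplex_ne_zero n))
      (.inl (volume_solidSimplex_ne_top n))]
  exact hr.trans (measure_mono (Set.subset_inter hA' hA))

/-- A measurable superset of the crossing set bounds the crossing probability from above. -/
lemma bcp_le {h : ℝ → ℝ} {B γ μ : ℝ} {n : ℕ} {X : Fin n → ℝ} {A : Set (Fin n → ℝ)}
    (hA : solidSimplex n ∩ crossingSet h B γ (fun i => X i - μ) ⊆ A) (hm : MeasurableSet A) {r : ℝ}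
    (hr0 : 0 ≤ r)
    (hr : volume A ≤ ENNReal.ofReal r * volume (solidSimplex n)) : bcp h B γ μ X ≤ r := by
  have hS := measurableSet_solidSimplex n
  rw [bcp, measureReal_def]
  refine ENNReal.toReal_le_of_le_ofReal hr0 ?_
  rw [dirichletOne_eq_map]
  set E := {w : Fin (n + 1) → ℝ | ∃ x : ℝ, μ ≤ x ∧
      μ ≤ (∑ i : Fin n, w i.castSucc * X i) + w (Fin.last n) * x ∧
      (∑ i : Fin n, w i.castSucc * h |X i - μ|) + w (Fin.last n) * (h |x - μ| - γ) ≤ B} with hE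
  -- Measurability of `E` is not available, so it is enlarged to a measurable set that adds only
  -- vectors outside the simplex or off the hyperplane of total mass one.
  let T : Set (Fin (n + 1) → ℝ) := {w | (fun i : Fin n => w i.castSucc) ∈ A ∪ (solidSimplex n)ᶜ ∨
    w (Fin.last n) ≠ 1 - ∑ i : Fin n, w i.castSucc}
  have hinit : Measurable fun (w : Fin (n + 1) → ℝ) (i : Fin n) => w i.castSucc := by fun_prop
  have hT : MeasurableSet T := by
    refine (hinit (hm.union hS.compl)).union (MeasurableSet.compl ?_)
    exact measurableSet_eq_fun (by fun_prop) (by fun_prop)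
  have hpre : simplexEmbedding ⁻¹' T = A ∪ (solidSimplex n)ᶜ := by
    ext u
    simp [T, simplexEmbedding]
  have hET : E ⊆ T := by
    intro w hw
    by_cases hlast : w (Fin.last n) = 1 - ∑ i : Fin n, w i.castSucc
    · left
      have hwe : simplexEmbedding (fun i : Fin n => w i.castSucc) = w := by
        ext i
        refine Fin.lastCases ?_ (fun j => ?_) i <;> simp [simplexEmbedding, hlast]
      by_cases hs : (fun i : Fin n => w i.castSucc) ∈ solidSimplex n
      · left
        refine hA ⟨hs, ?_⟩
        rw [← preimage_crossing_event, Set.mem_preimage, hwe]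
        exact hw
      · exact Or.inr hs
    · exact Or.inr hlast
  refine (measure_mono hET).trans ?_
  rw [Measure.map_apply measurable_simplexEmbedding hT, hpre, ProbabilityTheory.cond_apply hS,
    ← ENNReal.div_eq_inv_mul, ENNReal.div_le_iff (volume_solidSimplex_ne_zero n)
      (volume_solidSimplex_ne_top n)]
  refine (measure_mono ?_).trans hr
  rintro u ⟨hu, hu' | hu'⟩
  · exact hu'
  · exact absurd hu hu'

lemma volume_preimage_mul {n : ℕ} (D : Fin n → ℝ) (hD : ∀ i, 0 < D i) (s : Set (Fin n → ℝ)) :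
    volume ((fun (u : Fin n → ℝ) i => D i * u i) ⁻¹' s) = ENNReal.ofReal (∏ i, D i)⁻¹ * volume s := by
  have hdet : (Matrix.toLin' (Matrix.diagonal D)).det = ∏ i, D i := by
    rw [LinearMap.det_toLin', Matrix.det_diagonal]
  have hpos : 0 < ∏ i, D i := Finset.prod_pos fun i _ => hD i
  have := Measure.addHaar_preimage_linearMap volume (f := Matrix.toLin' (Matrix.diagonal D))
    (by rw [hdet]; exact hpos.ne') s
  rw [hdet, abs_of_pos (inv_pos.2 hpos)] at this
  rw [← this]
  congr 1
  ext u
  simp only [Set.mem_preimage, Matrix.toLin'_apply]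
  rw [show (Matrix.diagonal D).mulVec u = fun i => D i * u i from
    funext fun i => Matrix.mulVec_diagonal D u i]

/-! ### The dual problem and the upper bound -/

variable {h : ℝ → ℝ} {B η γ μ : ℝ}

/-- Testing the constraint at `x = μ` bounds `β`, and then testing it at `x = μ + 1` bounds `α`. -/
lemma isCompact_dualSet (hB : 0 < B) (hη : 0 ≤ η) (hγ : 0 < γ) (h : ℝ → ℝ) (h0 : h 0 = 0)
    (μ : ℝ) : IsCompact (dualSet h B η γ μ) := by
  have hcl : IsClosed (dualSet h B η γ μ) := by
    simp only [dualSet, Set.ofPred_and, Set.ofPred_forall]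
    refine (isClosed_le continuous_const continuous_fst).inter
      ((isClosed_le continuous_const continuous_snd).inter (isClosed_iInter fun x => ?_))
    exact isClosed_le continuous_const (by fun_prop)
  refine Metric.isCompact_of_isClosed_isBounded hcl ?_
  refine (Metric.isBounded_Icc (0 : ℝ × ℝ) (1 + 1 / (B + γ) * |h 1|, 1 / (B + γ))).subset ?_
  rintro ⟨α, β⟩ ⟨hα, hβ, hp⟩
  dsimp only at hα hβ hp
  have hβ' : β ≤ 1 / (B + γ) := by
    have := hp μ
    simp only [sub_self, abs_zero, h0, sub_zero, add_sub_cancel_left] at this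
    rw [le_div_iff₀ (by positivity)]
    nlinarith
  refine ⟨⟨hα, hβ⟩, ?_, hβ'⟩
  have := hp (μ + 1)
  rw [show μ + 1 + η - μ = 1 + η by ring, show μ + 1 - μ = 1 by ring, abs_one] at this
  have h1 : β * h 1 ≤ 1 / (B + γ) * |h 1| :=
    (mul_le_mul_of_nonneg_left (le_abs_self _) hβ).trans (by gcongr)
  have h2 : 0 ≤ β * (B + γ) := by positivity
  have h3 : 0 ≤ α * η := by positivity
  show α ≤ 1 + 1 / (B + γ) * |h 1|
  linarith

/-- If `β > 0`, dropping `γ` from the constraint leaves a margin `β γ`. If `β = 0`, large `x` forces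
`α = 0`, and the value is `1`. -/
lemma dual_pos {p : ℝ × ℝ} (hη : 0 ≤ η) (hγ : 0 < γ)
    (hp : p ∈ dualSet h B η γ μ) (x : ℝ) : 0 < 1 - p.1 * (x - μ) - p.2 * (B - h |x - μ|) := by
  obtain ⟨α, β⟩ := p
  obtain ⟨hα, hβ, hp⟩ := hp
  dsimp only at *
  have hx := hp x
  have h3 : 0 ≤ α * η := by positivity
  rcases hβ.eq_or_lt with rfl | hβ
  · have hα0 : α = 0 := by
      by_contra hne
      have hα : 0 < α := lt_of_le_of_ne hα (Ne.symm hne)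
      have := hp (μ + 2 / α)
      have h4 : α * (2 / α) = 2 := mul_div_cancel₀ _ hα.ne'
      nlinarith
    subst hα0
    norm_num
  · have := mul_pos hβ hγ
    nlinarith

lemma dualObjective_empirical {n : ℕ} (X : Fin n → ℝ) (p : ℝ × ℝ) :
    dualObjective h B (empirical X) μ p =
      (n : ℝ)⁻¹ * ∑ i, Real.log (1 - p.1 * (X i - μ) - p.2 * (B - h |X i - μ|)) :=
  integral_empirical X _

lemma isGreatest_lambdaStar (hh : IsMomentFunction h) (hB : 0 < B) (hγ : 0 < γ) (hη : 0 ≤ η)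
    {n : ℕ} (X : Fin n → ℝ) (μ : ℝ) :
    IsGreatest (dualObjective h B (empirical X) μ '' dualSet h B η γ μ)
      (lambdaStar h B η γ (empirical X) μ) := by
  have hc := isCompact_dualSet hB hη hγ h hh.map_zero μ
  have hcont : ContinuousOn (dualObjective h B (empirical X) μ) (dualSet h B η γ μ) := by
    have : dualObjective h B (empirical X) μ = fun p => (n : ℝ)⁻¹ *
        ∑ i, Real.log (1 - p.1 * (X i - μ) - p.2 * (B - h |X i - μ|)) :=
      funext (dualObjective_empirical X)
    rw [this]
    refine continuousOn_const.mul (continuousOn_finsetSum _ fun i _ => ?_)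
    exact ContinuousOn.log (by fun_prop) fun p hp => (dual_pos hη hγ hp _).ne'
  refine (hc.image_of_continuousOn hcont).isGreatest_sSup (Set.Nonempty.image _ ⟨0, ?_⟩)
  simp [dualSet]

lemma exp_neg_mul_mean_log {n : ℕ} (hn : 1 ≤ n) {D : Fin n → ℝ} (hD : ∀ i, 0 < D i) :
    Real.exp (-(n * ((n : ℝ)⁻¹ * ∑ i, Real.log (D i)))) = (∏ i, D i)⁻¹ := by
  have : (n : ℝ) ≠ 0 := by positivity
  rw [mul_inv_cancel_left₀ this, Real.exp_neg, Real.exp_sum]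
  simp [Real.exp_log (hD _)]

/-- The crossing probability is at most the exponential of the dual value, for every `η ≥ 0`. -/
lemma bcp_le_exp_lambdaStar (hh : IsMomentFunction h) (hB : 0 < B) (hγ : 0 < γ) (hη : 0 ≤ η)
    {n : ℕ} (hn : 1 ≤ n) (X : Fin n → ℝ) (μ : ℝ) :
    bcp h B γ μ X ≤ Real.exp (-(n * lambdaStar h B η γ (empirical X) μ)) := by
  obtain ⟨p, hp, hpΛ⟩ := (isGreatest_lambdaStar hh hB hγ hη X μ).1
  set D : Fin n → ℝ := fun i => 1 - p.1 * (X i - μ) - p.2 * (B - h |X i - μ|) with hDdef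
  have hD : ∀ i, 0 < D i := fun i => dual_pos hη hγ hp _
  rw [← hpΛ, dualObjective_empirical, exp_neg_mul_mean_log hn hD]
  have hv := volume_preimage_mul D hD (solidSimplex n)
  refine bcp_le (A := (fun (u : Fin n → ℝ) i => D i * u i) ⁻¹' solidSimplex n) ?_ ?_
    (inv_nonneg.2 (Finset.prod_nonneg fun i _ => (hD i).le)) hv.le
  · rintro u ⟨hu, y, hy, h1, h2⟩
    refine ⟨fun i => mul_nonneg (hD i).le (hu.1 i), ?_⟩
    obtain ⟨hα, hβ, hp⟩ := hp
    have hy' := hp (y + μ)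
    rw [show y + μ + η - μ = y + η by ring, add_sub_cancel_right, abs_of_nonneg hy] at hy'
    have hw : 0 ≤ 1 - ∑ i, u i := sub_nonneg.2 hu.2
    have hsum : ∑ i, D i * u i = ∑ i, u i - p.1 * ∑ i, u i * (X i - μ) +
        p.2 * ∑ i, u i * (h |X i - μ| - B) := by
      rw [Finset.mul_sum, Finset.mul_sum, ← Finset.sum_sub_distrib, ← Finset.sum_add_distrib]
      exact Finset.sum_congr rfl fun i _ => by rw [hDdef]; ring
    rw [hsum]
    -- Weak duality: both primal constraints and the dual constraint at the extra point are weighted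
    -- by their multipliers and added; the term `α η` only helps.
    have e1 := mul_nonneg hα h1
    have e2 := mul_nonneg hβ (neg_nonneg.2 h2)
    have e3 := mul_nonneg hw hy'
    have e4 := mul_nonneg hw (mul_nonneg hα hη)
    nlinarith
  · exact (measurableSet_solidSimplex n).preimage (by fun_prop)

/-! ### The lower bound for every `n` -/

lemma volume_smul_solidSimplex {n : ℕ} {r : ℝ} (hr : 0 ≤ r) :
    volume {u : Fin n → ℝ | ∃ v ∈ solidSimplex n, u = fun i => r * v i} =
      ENNReal.ofReal (r ^ n) * volume (solidSimplex n) := by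
  have := Measure.addHaar_smul (volume : Measure (Fin n → ℝ)) r (solidSimplex n)
  rw [Module.finrank_fin_fun, abs_of_nonneg (by positivity)] at this
  rw [← this]
  congr 1
  ext u
  simp only [Set.mem_smul_set, Set.mem_ofPred_eq]
  exact exists_congr fun v => and_congr_right fun _ => eq_comm

lemma pow_le_bcp (hh : IsMomentFunction h) (hB : 0 < B) (hγ : 0 < γ) {n : ℕ} (hn : 1 ≤ n)
    (X : Fin n → ℝ) (μ : ℝ) (hμ : |μ| < hInv h B)
    (hF : ∫ x, h |x - μ| ∂(empirical X) ≤ B) :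
    Real.exp (-(n * Real.log (n * constCB h B μ))) ≤ bcp h B γ μ X := by
  set b := hInv h B with hb
  have hhb : h b = B := hh.apply_hInv hB
  obtain ⟨hμ1, hμ2⟩ := abs_lt.1 hμ
  -- The two entries of `constCB` express exactly `b / C ≤ (1 - 1 / C) y` and `B / C + h y ≤ B`: the
  -- extra point outweighs the worst contribution of the observations in each constraint.
  set y := (b - μ) / 2 with hy
  have hy0 : 0 < y := by rw [hy]; linarith
  have hyb : y < b := by rw [hy]; linarith
  have hhy : h y < B := hhb ▸ hh.strictMonoOn hy0.le (hy0.trans hyb).le hyb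
  set C := constCB h B μ with hC
  have hC1 : (3 * b - μ) / (b - μ) ≤ C := le_max_left _ _
  have hC2 : B / (B - h y) ≤ C := le_max_right _ _
  have hbμ : 0 < b - μ := by linarith
  rw [div_le_iff₀ hbμ] at hC1
  rw [div_le_iff₀ (sub_pos.2 hhy)] at hC2
  have hCpos : 1 < C := by nlinarith
  have hC0 : 0 < C := by linarith
  have hn' : (1 : ℝ) ≤ n := by exact_mod_cast hn
  have hn0 : (0 : ℝ) < n := by linarith
  have hnC : 0 < n * C := by positivity
  have hsum : ∑ i, h |X i - μ| ≤ n * B := by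
    rw [integral_empirical (f := fun x => h |x - μ|), inv_mul_le_iff₀ hn0] at hF
    exact hF
  have hhY : ∀ i, h |X i - μ| ≤ n * B := fun i =>
    (Finset.single_le_sum (f := fun i => h |X i - μ|) (fun j _ => hh.nonneg (abs_nonneg _))
      (Finset.mem_univ i)).trans hsum
  -- Convexity gives `h (|Y i| / n) ≤ h |Y i| / n ≤ B = h b`, and `h` is strictly increasing.
  have hY : ∀ i, |X i - μ| ≤ n * b := by
    intro i
    have h1 := hh.map_mul_le (t := (n : ℝ)⁻¹) (x := |X i - μ|) (by positivity)
      (inv_le_one_of_one_le₀ hn') (abs_nonneg _)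
    have h2 : h ((n : ℝ)⁻¹ * |X i - μ|) ≤ h b := by
      rw [hhb]
      refine h1.trans ?_
      rw [inv_mul_le_iff₀ hn0]
      exact hhY i
    have h3 := (hh.strictMonoOn.le_iff_le (Set.mem_Ici.2 (by positivity))
      (Set.mem_Ici.2 (hy0.trans hyb).le)).1 h2
    rwa [inv_mul_le_iff₀ hn0] at h3
  have hr0 : 0 ≤ (n * C)⁻¹ := by positivity
  refine le_bcp (A := {u | ∃ v ∈ solidSimplex n, u = fun i => (n * C)⁻¹ * v i}) ?_ ?_ ?_
  · rintro u ⟨v, hv, rfl⟩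
    have hvs : 0 ≤ ∑ i, v i := Finset.sum_nonneg fun i _ => hv.1 i
    have hs : ∑ i, (n * C)⁻¹ * v i ≤ C⁻¹ := by
      rw [← Finset.mul_sum]
      calc (n * C)⁻¹ * ∑ i, v i ≤ (1 * C)⁻¹ * 1 := by gcongr; exact hv.2
        _ = C⁻¹ := by simp
    have hs0 : 0 ≤ ∑ i, (n * C)⁻¹ * v i := by
      rw [← Finset.mul_sum]; positivity
    have bound : ∀ (z : Fin n → ℝ) (K : ℝ), 0 ≤ K → (∀ i, z i ≤ n * K) →
        ∑ i, (n * C)⁻¹ * v i * z i ≤ K * C⁻¹ := by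
      intro z K hK hz
      calc ∑ i, (n * C)⁻¹ * v i * z i ≤ ∑ i, (n * C)⁻¹ * v i * (n * K) :=
            Finset.sum_le_sum fun i _ =>
              mul_le_mul_of_nonneg_left (hz i) (mul_nonneg hr0 (hv.1 i))
        _ = (K * C⁻¹) * ∑ i, v i := by
            rw [Finset.mul_sum]
            refine Finset.sum_congr rfl fun i _ => ?_
            field_simp
        _ ≤ K * C⁻¹ * 1 := by gcongr; exact hv.2
        _ = K * C⁻¹ := mul_one _
    have b1 := bound (fun i => -(X i - μ)) b (hy0.trans hyb).le
      fun i => (neg_le_abs _).trans (hY i)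
    have b2 := bound (fun i => h |X i - μ|) B hB.le hhY
    have hCinv : C * C⁻¹ = 1 := mul_inv_cancel₀ hC0.ne'
    have hCi : 0 < C⁻¹ := by positivity
    refine ⟨y, hy0.le, ?_, ?_⟩
    · have h1 : (1 - C⁻¹) * y ≤ (1 - ∑ i, (n * C)⁻¹ * v i) * y := by gcongr
      have h2 : b * C⁻¹ ≤ (1 - C⁻¹) * y := by
        have := mul_le_mul_of_nonneg_right hC1 hCi.le
        rw [hy]
        nlinarith
      simp only [mul_neg, Finset.sum_neg_distrib] at b1
      linarith
    · have h2 : B * C⁻¹ + h y ≤ B := by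
        have := mul_le_mul_of_nonneg_right hC2 hCi.le
        nlinarith
      have h3 : 0 ≤ (∑ i, (n * C)⁻¹ * v i) * h y := mul_nonneg hs0 (hh.nonneg hy0.le)
      have h4 : 0 ≤ (1 - ∑ i, (n * C)⁻¹ * v i) * γ := by
        refine mul_nonneg ?_ hγ.le
        have := inv_le_one_of_one_le₀ hCpos.le
        linarith
      simp only [mul_sub, Finset.sum_sub_distrib, ← Finset.sum_mul] at b2 ⊢
      nlinarith
  · rintro u ⟨v, hv, rfl⟩
    have hle : (n * C)⁻¹ ≤ 1 := inv_le_one_of_one_le₀ (by nlinarith)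
    refine ⟨fun i => mul_nonneg hr0 (hv.1 i), ?_⟩
    rw [← Finset.mul_sum]
    have := Finset.sum_nonneg fun i (_ : i ∈ Finset.univ) => hv.1 i
    nlinarith [hv.2]
  · rw [volume_smul_solidSimplex hr0, Real.exp_neg, mul_comm (n : ℝ) (Real.log _),
      Real.exp_mul, Real.exp_log hnC, Real.rpow_natCast, inv_pow]

/-! ### Strong duality -/

/-- Joint convexity of the perspective of a moment function. -/
lemma IsMomentFunction.exists_perspective (hh : IsMomentFunction h) {s₁ s₂ y₁ y₂ : ℝ}
    (hs₁ : 0 ≤ s₁) (hs₂ : 0 ≤ s₂) (hy₁ : 0 ≤ y₁) (hy₂ : 0 ≤ y₂) :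
    ∃ y, 0 ≤ y ∧ (s₁ + s₂) * y = s₁ * y₁ + s₂ * y₂ ∧
      (s₁ + s₂) * h y ≤ s₁ * h y₁ + s₂ * h y₂ := by
  rcases (add_nonneg hs₁ hs₂).eq_or_lt with hs | hs
  · have h1 : s₁ = 0 := by linarith
    have h2 : s₂ = 0 := by linarith
    exact ⟨0, le_rfl, by simp [h1, h2], by simp [h1, h2]⟩
  · refine ⟨(s₁ * y₁ + s₂ * y₂) / (s₁ + s₂), by positivity, mul_div_cancel₀ _ hs.ne', ?_⟩
    have := hh.convex.2 (Set.mem_Ici.2 hy₁) (Set.mem_Ici.2 hy₂)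
      (by positivity : 0 ≤ s₁ / (s₁ + s₂)) (by positivity : 0 ≤ s₂ / (s₁ + s₂))
      (by rw [← add_div, div_self hs.ne'])
    simp only [smul_eq_mul] at this
    rw [show s₁ / (s₁ + s₂) * y₁ + s₂ / (s₁ + s₂) * y₂ = (s₁ * y₁ + s₂ * y₂) / (s₁ + s₂) by ring,
      show s₁ / (s₁ + s₂) * h y₁ + s₂ / (s₁ + s₂) * h y₂ = (s₁ * h y₁ + s₂ * h y₂) / (s₁ + s₂) by
      ring, le_div_iff₀ hs] at this
    linarith

/-- The achievable values of the two constraints and of the logarithmic objective, over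
unnormalized weights. -/
def achievableSet (h : ℝ → ℝ) (B γ : ℝ) {n : ℕ} (Y : Fin n → ℝ) : Set (ℝ × ℝ × ℝ) :=
  {z | ∃ (e : Fin n → ℝ) (s y : ℝ), (∀ i, 0 < e i) ∧ 0 ≤ s ∧ 0 ≤ y ∧
    z.1 ≤ ∑ i, e i * Y i + s * y ∧
    z.2.1 ≤ ∑ i, e i * (B - h |Y i|) + s * (γ + B - h y) ∧
    ∑ i, e i + s - (n : ℝ)⁻¹ * ∑ i, Real.log (e i) ≤ z.2.2}

/-- The terms `s * y` and `s * h y` are not jointly linear in `(s, y)`. The perspective lemma merges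
two extra points into one with the same first moment and no larger `h`-moment; concavity of `log`
handles the objective. -/
lemma convex_achievableSet (hh : IsMomentFunction h) {n : ℕ} (Y : Fin n → ℝ) :
    Convex ℝ (achievableSet h B γ Y) := by
  rintro ⟨a₁, b₁, c₁⟩ ⟨e₁, s₁, y₁, he₁, hs₁, hy₁, ha₁, hb₁, hc₁⟩ ⟨a₂, b₂, c₂⟩
    ⟨e₂, s₂, y₂, he₂, hs₂, hy₂, ha₂, hb₂, hc₂⟩ t r ht hr htr
  dsimp only at *
  obtain ⟨y, hy, hy1, hy2⟩ := hh.exists_perspective (mul_nonneg ht hs₁) (mul_nonneg hr hs₂) hy₁ hy₂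
  have hsum : ∀ z : Fin n → ℝ, ∑ i, (t * e₁ i + r * e₂ i) * z i =
      t * ∑ i, e₁ i * z i + r * ∑ i, e₂ i * z i := by
    intro z
    rw [Finset.mul_sum, Finset.mul_sum, ← Finset.sum_add_distrib]
    exact Finset.sum_congr rfl fun i _ => by ring
  have hsum1 := hsum 1
  simp only [Pi.one_apply, mul_one] at hsum1
  have hlog : t * ∑ i, Real.log (e₁ i) + r * ∑ i, Real.log (e₂ i) ≤
      ∑ i, Real.log (t * e₁ i + r * e₂ i) := by
    rw [Finset.mul_sum, Finset.mul_sum, ← Finset.sum_add_distrib]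
    exact Finset.sum_le_sum fun i _ =>
      strictConcaveOn_log_Ioi.concaveOn.2 (Set.mem_Ioi.2 (he₁ i)) (Set.mem_Ioi.2 (he₂ i)) ht hr htr
  have hlog' := mul_le_mul_of_nonneg_left hlog (by positivity : (0 : ℝ) ≤ (n : ℝ)⁻¹)
  refine ⟨fun i => t * e₁ i + r * e₂ i, t * s₁ + r * s₂, y, fun i => ?_, by positivity, hy,
    ?_, ?_, ?_⟩
  · rcases ht.eq_or_lt with rfl | ht
    · have : r = 1 := by linarith
      simpa [this] using he₂ i
    · have := mul_pos ht (he₁ i)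
      have := mul_nonneg hr (he₂ i).le
      linarith
  · rw [hsum, hy1]
    have := mul_le_mul_of_nonneg_left ha₁ ht
    have := mul_le_mul_of_nonneg_left ha₂ hr
    simp only [Prod.smul_mk, Prod.mk_add_mk, smul_eq_mul]
    linarith
  · rw [hsum]
    have := mul_le_mul_of_nonneg_left hb₁ ht
    have := mul_le_mul_of_nonneg_left hb₂ hr
    simp only [Prod.smul_mk, Prod.mk_add_mk, smul_eq_mul]
    linarith
  · rw [hsum1]
    have := mul_le_mul_of_nonneg_left hc₁ ht
    have := mul_le_mul_of_nonneg_left hc₂ hr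
    simp only [Prod.smul_mk, Prod.mk_add_mk, smul_eq_mul]
    linarith

lemma nonneg_of_forall_le_add_mul {c m κ : ℝ} (H : ∀ s : ℝ, 0 ≤ s → m ≤ c + s * κ) : 0 ≤ κ := by
  by_contra! hκ
  have := H ((|c - m| + 1) / -κ) (div_nonneg (by positivity) (by linarith))
  rw [div_mul_eq_mul_div, div_neg, mul_div_cancel_right₀ _ hκ.ne] at this
  have := le_abs_self (c - m)
  linarith

/-- Separating the achievable set from the open octant below a level `m` which is not achieved
yields Lagrange multipliers. -/
lemma exists_multipliers (hh : IsMomentFunction h) (hB : 0 < B) (hγ : 0 < γ) {n : ℕ}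
    (Y : Fin n → ℝ) {m : ℝ}
    (hdisj : ∀ z ∈ achievableSet h B γ Y, 0 < z.1 → 0 < z.2.1 → m ≤ z.2.2) :
    ∃ α β : ℝ, 0 ≤ α ∧ 0 ≤ β ∧
      ∀ z ∈ achievableSet h B γ Y, m ≤ z.2.2 - α * z.1 - β * z.2.1 := by
  let O : Set (ℝ × ℝ × ℝ) := Set.Ioi 0 ×ˢ Set.Ioi 0 ×ˢ Set.Iio m
  have hO : IsOpen O := isOpen_Ioi.prod (isOpen_Ioi.prod isOpen_Iio)
  have hOc : Convex ℝ O := (convex_Ioi 0).prod ((convex_Ioi 0).prod (convex_Iio m))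
  have hd : Disjoint O (achievableSet h B γ Y) :=
    Set.disjoint_left.2 fun z hz hz' => (hdisj z hz' hz.1 hz.2.1).not_gt hz.2.2
  obtain ⟨f, s₀, hfO, hfC⟩ := geometric_hahn_banach_open hOc hO (convex_achievableSet hh Y) hd
  set f₁ := f (1, 0, 0) with hf₁
  set f₂ := f (0, 1, 0) with hf₂
  set f₃ := f (0, 0, 1) with hf₃
  have hf : ∀ a b c : ℝ, f (a, b, c) = f₁ * a + f₂ * b + f₃ * c := by
    intro a b c
    have : ((a, b, c) : ℝ × ℝ × ℝ) = a • (1, 0, 0) + b • (0, 1, 0) + c • (0, 0, 1) := by simp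
    rw [this, map_add, map_add, map_smul, map_smul, map_smul]
    simp only [smul_eq_mul]
    ring
  have hO' : ∀ a b c : ℝ, 0 < a → 0 < b → c < m → f₁ * a + f₂ * b + f₃ * c < s₀ :=
    fun a b c ha hb hc => hf a b c ▸ hfO (a, b, c) ⟨ha, hb, hc⟩
  -- The functional is bounded above on an octant, whose unbounded directions fix the three signs.
  have h₁ : f₁ ≤ 0 := by
    rw [← neg_nonneg]
    refine nonneg_of_forall_le_add_mul (c := s₀) (m := f₁ + f₂ + f₃ * (m - 1)) fun s hs => ?_
    have := hO' (1 + s) 1 (m - 1) (by linarith) one_pos (by linarith)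
    linarith
  have h₂ : f₂ ≤ 0 := by
    rw [← neg_nonneg]
    refine nonneg_of_forall_le_add_mul (c := s₀) (m := f₁ + f₂ + f₃ * (m - 1)) fun s hs => ?_
    have := hO' 1 (1 + s) (m - 1) one_pos (by linarith) (by linarith)
    linarith
  have h₃ : 0 ≤ f₃ := by
    refine nonneg_of_forall_le_add_mul (c := s₀) (m := f₁ + f₂ + f₃ * (m - 1)) fun s hs => ?_
    have := hO' 1 1 (m - 1 - s) one_pos one_pos (by linarith)
    linarith
  -- The corner `(0, 0, m)` lies in the closure of the octant.
  have hm : f₃ * m ≤ s₀ := by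
    by_contra! hlt
    set ε := (f₃ * m - s₀) / (f₃ - f₁ - f₂ + 1) with hε
    have hden : 0 < f₃ - f₁ - f₂ + 1 := by linarith
    have hε0 : 0 < ε := div_pos (by linarith) hden
    have h4 : ε * (f₃ - f₁ - f₂ + 1) = f₃ * m - s₀ := div_mul_cancel₀ _ hden.ne'
    have := hO' ε ε (m - ε) hε0 hε0 (by linarith)
    nlinarith
  obtain ⟨y₀, hy₀, hhy₀⟩ := hh.exists_pos_le hB
  -- Slater's condition: since `h y₀ ≤ B`, a large mass `S` at `y₀` makes both constraints strictly
  -- positive. If `f₃ = 0`, separation at that point forces `f₁ = f₂ = 0`, contradicting strictness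
  -- on the octant.
  have h₃' : 0 < f₃ := by
    refine lt_of_le_of_ne h₃ fun h30 => ?_
    set S := |∑ i, Y i| / y₀ + |∑ i, (B - h |Y i|)| / γ + 1 with hS
    have hS1 : |∑ i, Y i| < S * y₀ := by
      have : |∑ i, Y i| / y₀ < S := by
        rw [hS]; have : 0 ≤ |∑ i, (B - h |Y i|)| / γ := by positivity
        linarith
      rwa [div_lt_iff₀ hy₀] at this
    have hS2 : |∑ i, (B - h |Y i|)| < S * γ := by
      have : |∑ i, (B - h |Y i|)| / γ < S := by
        rw [hS]; have : 0 ≤ |∑ i, Y i| / y₀ := by positivity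
        linarith
      rwa [div_lt_iff₀ hγ] at this
    have hS0 : 0 ≤ S := by positivity
    have ha : 0 < ∑ i, Y i + S * y₀ := by linarith [neg_abs_le (∑ i, Y i)]
    have hb : 0 < ∑ i, (B - h |Y i|) + S * (γ + B - h y₀) := by
      have := mul_le_mul_of_nonneg_left hhy₀ hS0
      linarith [neg_abs_le (∑ i, (B - h |Y i|))]
    have hp := hfC (∑ i, Y i + S * y₀, ∑ i, (B - h |Y i|) + S * (γ + B - h y₀), n + S)
      ⟨fun _ => 1, S, y₀, fun _ => one_pos, hS0, hy₀.le, by simp, by simp, by simp⟩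
    rw [hf, ← h30] at hp
    rw [← h30] at hm
    have e1 := mul_nonneg_of_nonpos_of_nonpos h₁ (neg_nonpos.2 ha.le)
    have e2 := mul_nonneg_of_nonpos_of_nonpos h₂ (neg_nonpos.2 hb.le)
    have hf1 : f₁ = 0 := by
      have : f₁ * (∑ i, Y i + S * y₀) = 0 := by linarith
      exact (mul_eq_zero.1 this).resolve_right ha.ne'
    have hf2 : f₂ = 0 := by
      have : f₂ * (∑ i, (B - h |Y i|) + S * (γ + B - h y₀)) = 0 := by linarith
      exact (mul_eq_zero.1 this).resolve_right hb.ne'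
    have := hO' 1 1 (m - 1) one_pos one_pos (by linarith)
    rw [hf1, hf2, ← h30] at this
    rw [hf1, hf2] at hp
    linarith
  refine ⟨-f₁ / f₃, -f₂ / f₃, div_nonneg (by linarith) h₃, div_nonneg (by linarith) h₃, ?_⟩
  rintro ⟨a, b, c⟩ hz
  have := hm.trans (hfC _ hz)
  rw [hf] at this
  have h5 : c - -f₁ / f₃ * a - -f₂ / f₃ * b = (f₁ * a + f₂ * b + f₃ * c) / f₃ := by
    field_simp; ring
  show m ≤ c - -f₁ / f₃ * a - -f₂ / f₃ * b
  rw [h5, le_div_iff₀ h₃']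
  linarith

/-- Strong duality, up to `δ`: some point of the crossing set has a product of weights of the
order prescribed by the dual value. -/
lemma exists_mem_crossingSet (hh : IsMomentFunction h) (hB : 0 < B) (hγ : 0 < γ) {n : ℕ}
    (hn : 1 ≤ n) (X : Fin n → ℝ) (μ : ℝ) {δ : ℝ} (hδ : 0 < δ) :
    ∃ u ∈ crossingSet h B γ fun i => X i - μ, (∀ i, 0 < u i) ∧ ∑ i, u i ≤ 1 ∧
      Real.exp (-(n * (lambdaStar h B 0 γ (empirical X) μ + δ))) ≤ ∏ i, n * u i := by
  by_contra! hcon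
  have hn0 : (0 : ℝ) < n := by exact_mod_cast hn
  set Λ := lambdaStar h B 0 γ (empirical X) μ with hΛ
  set Y : Fin n → ℝ := fun i => X i - μ with hY
  have hne : Nonempty (Fin n) := ⟨⟨0, hn⟩⟩
  -- Dividing by the total mass `T` gives a crossing point, to which the assumed failure applies.
  -- The term `1` comes from `log T ≤ T - 1`.
  have hdisj : ∀ z ∈ achievableSet h B γ Y, 0 < z.1 → 0 < z.2.1 →
      Λ + δ + 1 + Real.log n ≤ z.2.2 := by
    rintro ⟨a, b, c⟩ ⟨e, s, y, he, hs, hy, ha, hb, hc⟩ ha0 hb0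
    dsimp only at *
    have hE : 0 < ∑ i, e i := Finset.sum_pos (fun i _ => he i) Finset.univ_nonempty
    set T := ∑ i, e i + s with hT
    have hT0 : 0 < T := by linarith
    have hlast : 1 - ∑ i, e i / T = s / T := by
      rw [← Finset.sum_div, eq_div_iff hT0.ne', sub_mul, div_mul_cancel₀ _ hT0.ne']
      linarith
    have hu := hcon (fun i => e i / T) ⟨y, hy, ?_, ?_⟩ (fun i => div_pos (he i) hT0) ?_
    · have hlog := Real.log_lt_log (Finset.prod_pos fun i _ => by have := he i; positivity) hu
      rw [Real.log_exp, Real.log_prod fun i _ => by have := he i; positivity] at hlog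
      have hterm : ∀ i, Real.log (n * (e i / T)) = Real.log n + Real.log (e i) - Real.log T := by
        intro i
        have := he i
        rw [Real.log_mul hn0.ne' (by positivity), Real.log_div this.ne' hT0.ne']
        ring
      simp only [hterm, Finset.sum_sub_distrib, Finset.sum_add_distrib, Finset.sum_const,
        Finset.card_univ, Fintype.card_fin, nsmul_eq_mul] at hlog
      have hTlog : Real.log T ≤ T - 1 := Real.log_le_sub_one_of_pos hT0
      have hdiv : (n : ℝ)⁻¹ * ∑ i, Real.log (e i) ≤ Real.log T - Real.log n - (Λ + δ) := by
        rw [inv_mul_le_iff₀ hn0]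
        linarith
      linarith
    · rw [hlast]
      simp only [div_mul_eq_mul_div, ← Finset.sum_div]
      rw [← add_div]
      exact div_nonneg (by linarith) hT0.le
    · rw [hlast]
      simp only [div_mul_eq_mul_div, ← Finset.sum_div]
      rw [← add_div]
      refine div_nonpos_of_nonpos_of_nonneg ?_ hT0.le
      have : ∑ i, e i * (h |Y i| - B) = -∑ i, e i * (B - h |Y i|) := by
        rw [← Finset.sum_neg_distrib]
        exact Finset.sum_congr rfl fun i _ => by ring
      rw [this]
      linarith
    · have : 0 ≤ s / T := by positivity
      linarith
  obtain ⟨α, β, hα, hβ, hmult⟩ := exists_multipliers hh hB hγ Y hdisj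
  have hlag : ∀ (e : Fin n → ℝ) (s y : ℝ), (∀ i, 0 < e i) → 0 ≤ s → 0 ≤ y →
      Λ + δ + 1 + Real.log n ≤ ∑ i, e i * (1 - α * Y i - β * (B - h |Y i|)) -
        (n : ℝ)⁻¹ * ∑ i, Real.log (e i) + s * (1 - α * y - β * (γ + B - h y)) := by
    intro e s y he hs hy
    have := hmult (∑ i, e i * Y i + s * y, ∑ i, e i * (B - h |Y i|) + s * (γ + B - h y),
      ∑ i, e i + s - (n : ℝ)⁻¹ * ∑ i, Real.log (e i)) ⟨e, s, y, he, hs, hy, le_rfl, le_rfl, le_rfl⟩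
    dsimp only at this
    refine this.trans_eq ?_
    have : ∑ i, e i * (1 - α * Y i - β * (B - h |Y i|)) = ∑ i, e i - α * ∑ i, e i * Y i -
        β * ∑ i, e i * (B - h |Y i|) := by
      rw [Finset.mul_sum, Finset.mul_sum, ← Finset.sum_sub_distrib, ← Finset.sum_sub_distrib]
      exact Finset.sum_congr rfl fun i _ => by ring
    rw [this]
    ring
  -- The Lagrangian is bounded below as `s → ∞`, so the coefficient of `s` is nonnegative.
  have hmem : (α, β) ∈ dualSet h B 0 γ μ := by
    refine ⟨hα, hβ, fun x => ?_⟩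
    have h1 : 0 ≤ 1 - α * |x - μ| - β * (γ + B - h |x - μ|) :=
      nonneg_of_forall_le_add_mul fun s hs =>
        hlag (fun _ => 1) s |x - μ| (fun _ => one_pos) hs (abs_nonneg _)
    have h2 := mul_le_mul_of_nonneg_left (le_abs_self (x - μ)) hα
    show 0 ≤ 1 - α * (x + 0 - μ) - β * (B + γ - h |x - μ|)
    rw [add_zero]
    linarith
  have hD : ∀ i, 0 < 1 - α * Y i - β * (B - h |Y i|) := fun i => dual_pos le_rfl hγ hmem (X i)
  -- Each `e i = 1 / (n D i)` minimizes `e D i - log e / n`. The resulting value is `1 + log n` plus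
  -- the dual objective, hence at most `1 + log n + Λ`, which contradicts the extra `δ`.
  have hfin := hlag (fun i => (n * (1 - α * Y i - β * (B - h |Y i|)))⁻¹) 0 0
    (fun i => inv_pos.2 (mul_pos hn0 (hD i))) le_rfl le_rfl
  have hone : ∀ i, (n * (1 - α * Y i - β * (B - h |Y i|)))⁻¹ *
      (1 - α * Y i - β * (B - h |Y i|)) = (n : ℝ)⁻¹ := by
    intro i
    rw [mul_inv, mul_assoc, inv_mul_cancel₀ (hD i).ne', mul_one]
  have hle : dualObjective h B (empirical X) μ (α, β) ≤ Λ :=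
    (isGreatest_lambdaStar hh hB hγ le_rfl X μ).2 ⟨_, hmem, rfl⟩
  rw [dualObjective_empirical] at hle
  simp only [hone, Real.log_inv, Real.log_mul hn0.ne' (hD _).ne', Finset.sum_neg_distrib,
    Finset.sum_add_distrib, Finset.sum_const, Finset.card_univ, Fintype.card_fin,
    nsmul_eq_mul, mul_inv_cancel₀ hn0.ne', zero_mul, add_zero, mul_neg, mul_add,
    inv_mul_cancel_left₀ hn0.ne', sub_neg_eq_add] at hfin
  dsimp only at hle
  linarith

/-! ### Exponential laws and volumes -/

/-- The standard exponential density. -/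
noncomputable def expDensity (x : ℝ) : ℝ := (Set.Ici (0 : ℝ)).indicator (fun x => Real.exp (-x)) x

lemma expDensity_nonneg (x : ℝ) : 0 ≤ expDensity x :=
  Set.indicator_nonneg (fun _ _ => (Real.exp_pos _).le) x

lemma expDensity_le (x : ℝ) : expDensity x ≤ Real.exp (-x) :=
  Set.indicator_le_self' (fun _ _ => (Real.exp_pos _).le) x

lemma measurable_expDensity : Measurable expDensity :=
  Measurable.indicator (by fun_prop) measurableSet_Ici

lemma integrable_expDensity : Integrable expDensity := by
  have : Integrable ((Set.Ici (0 : ℝ)).indicator fun x => Real.exp (-x)) := by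
    rw [integrable_indicator_iff measurableSet_Ici, integrableOn_Ici_iff_integrableOn_Ioi]
    exact integrableOn_exp_neg_Ioi 0
  exact this

/-- The standard exponential distribution. -/
noncomputable def expLaw : Measure ℝ := ProbabilityTheory.expMeasure 1

instance : IsProbabilityMeasure expLaw := ProbabilityTheory.isProbabilityMeasure_expMeasure one_pos

lemma expLaw_eq : expLaw = volume.withDensity fun x => ENNReal.ofReal (expDensity x) := by
  show volume.withDensity (ProbabilityTheory.exponentialPDF 1) = _
  congr 1
  ext x
  rw [ProbabilityTheory.exponentialPDF_eq]
  simp [expDensity, Set.indicator]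

lemma integrable_expLaw_iff {g : ℝ → ℝ} :
    Integrable g expLaw ↔ IntegrableOn (fun x => Real.exp (-x) * g x) (Set.Ioi 0) := by
  rw [expLaw_eq, integrable_withDensity_iff_integrable_smul'
    measurable_expDensity.ennreal_ofReal (by simp), ← integrableOn_Ici_iff_integrableOn_Ioi,
    ← integrable_indicator_iff measurableSet_Ici]
  refine iff_of_eq (congrArg₂ _ (funext fun x => ?_) rfl)
  rw [ENNReal.toReal_ofReal (expDensity_nonneg x), expDensity, smul_eq_mul, Set.indicator_mul_left]

lemma integral_expLaw (g : ℝ → ℝ) :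
    ∫ x, g x ∂expLaw = ∫ x in Set.Ioi 0, Real.exp (-x) * g x := by
  rw [expLaw_eq, integral_withDensity_eq_integral_toReal_smul
    measurable_expDensity.ennreal_ofReal (by simp), ← integral_Ici_eq_integral_Ioi,
    ← integral_indicator measurableSet_Ici]
  refine integral_congr_ae (.of_forall fun x => ?_)
  show (ENNReal.ofReal (expDensity x)).toReal * g x = _
  rw [ENNReal.toReal_ofReal (expDensity_nonneg x), expDensity, Set.indicator_mul_left]

lemma integrable_pow_expLaw (k : ℕ) : Integrable (fun x => x ^ k) expLaw := by
  rw [integrable_expLaw_iff]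
  have := Real.GammaIntegral_convergent (s := k + 1) (by positivity)
  simpa using this

lemma integral_pow_expLaw (k : ℕ) : ∫ x, x ^ k ∂expLaw = k.factorial := by
  rw [integral_expLaw, ← Real.Gamma_nat_eq_factorial, Real.Gamma_eq_integral (by positivity)]
  simp

lemma memLp_id_expLaw : MemLp (fun x : ℝ => x) 2 expLaw :=
  (memLp_two_iff_integrable_sq (by fun_prop)).2 (integrable_pow_expLaw 2)

lemma variance_id_expLaw_le : ProbabilityTheory.variance (fun x : ℝ => x) expLaw ≤ 2 := by
  refine (ProbabilityTheory.variance_le_expectation_sq (by fun_prop)).trans_eq ?_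
  simpa using integral_pow_expLaw 2

/-- The law of `n` independent standard exponential variables. -/
noncomputable def expLawPi (n : ℕ) : Measure (Fin n → ℝ) := Measure.pi fun _ => expLaw

instance (n : ℕ) : IsProbabilityMeasure (expLawPi n) := by unfold expLawPi; infer_instance

lemma expLawPi_eq (n : ℕ) : expLawPi n =
    volume.withDensity fun g => ENNReal.ofReal (∏ i, expDensity (g i)) := by
  refine Measure.pi_eq fun s hs => ?_
  rw [withDensity_apply _ (MeasurableSet.univ_pi hs),
    ← lintegral_indicator (MeasurableSet.univ_pi hs)]
  have hint : ∀ i, Integrable ((s i).indicator expDensity) :=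
    fun i => integrable_expDensity.indicator (hs i)
  have hnn : ∀ i x, 0 ≤ (s i).indicator expDensity x :=
    fun i x => Set.indicator_nonneg (fun _ _ => expDensity_nonneg _) x
  have h1 : ∀ g : Fin n → ℝ, (Set.univ.pi s).indicator
      (fun g => ENNReal.ofReal (∏ i, expDensity (g i))) g =
      ENNReal.ofReal (∏ i, (s i).indicator expDensity (g i)) := by
    intro g
    by_cases hg : g ∈ Set.univ.pi s
    · rw [Set.indicator_of_mem hg]
      congr 1
      exact Finset.prod_congr rfl fun i _ => (Set.indicator_of_mem (hg i trivial) _).symm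
    · rw [Set.indicator_of_notMem hg]
      simp only [Set.mem_pi, Set.mem_univ, true_implies, not_forall] at hg
      obtain ⟨i, hi⟩ := hg
      rw [Finset.prod_eq_zero (Finset.mem_univ i) (Set.indicator_of_notMem hi _),
        ENNReal.ofReal_zero]
  simp only [h1]
  rw [volume_pi, ← ofReal_integral_eq_lintegral_ofReal (Integrable.fintype_prod hint)
    (.of_forall fun g => Finset.prod_nonneg fun i _ => hnn i _),
    integral_fintype_prod_eq_prod, ENNReal.ofReal_prod_of_nonneg fun i _ =>
      integral_nonneg (hnn i)]
  refine Finset.prod_congr rfl fun i _ => ?_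
  rw [ofReal_integral_eq_lintegral_ofReal (hint i) (.of_forall (hnn i)), expLaw_eq,
    withDensity_apply _ (hs i), ← lintegral_indicator (hs i)]
  refine lintegral_congr fun x => ?_
  by_cases hx : x ∈ s i <;> simp [hx]

lemma expLawPi_le_volume {n : ℕ} {T : Set (Fin n → ℝ)} (hT : MeasurableSet T) {a : ℝ}
    (ha : ∀ g ∈ T, a ≤ ∑ i, g i) :
    expLawPi n T ≤ ENNReal.ofReal (Real.exp (-a)) * volume T := by
  rw [expLawPi_eq, withDensity_apply _ hT, ← setLIntegral_const]
  refine setLIntegral_mono measurable_const fun g hg => ENNReal.ofReal_le_ofReal ?_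
  calc ∏ i, expDensity (g i) ≤ ∏ i, Real.exp (-g i) :=
        Finset.prod_le_prod (fun i _ => expDensity_nonneg _) fun i _ => expDensity_le _
    _ = Real.exp (-∑ i, g i) := by rw [← Real.exp_sum, Finset.sum_neg_distrib]
    _ ≤ Real.exp (-a) := Real.exp_le_exp.2 (neg_le_neg (ha g hg))

/-- On the simplex dilated by `n`, the product exponential density is at least `exp (-n)`, and its
integral there is at most `1`. -/
lemma volume_solidSimplex_le {n : ℕ} (hn : 1 ≤ n) :
    volume (solidSimplex n) ≤ ENNReal.ofReal (Real.exp n * ((n : ℝ) ^ n)⁻¹) := by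
  have hn0 : (0 : ℝ) < n := by exact_mod_cast hn
  set T : Set (Fin n → ℝ) := {u | ∃ v ∈ solidSimplex n, u = fun i => (n : ℝ) * v i} with hTdef
  have hT : T = (fun (u : Fin n → ℝ) i => (n : ℝ)⁻¹ * u i) ⁻¹' solidSimplex n := by
    ext u
    constructor
    · rintro ⟨v, hv, rfl⟩
      simpa [inv_mul_cancel_left₀ hn0.ne'] using hv
    · exact fun hu => ⟨_, hu, by simp [mul_inv_cancel_left₀ hn0.ne']⟩
  have hTm : MeasurableSet T := by
    rw [hT]
    exact (measurableSet_solidSimplex n).preimage (by fun_prop)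
  have hvol : volume T = ENNReal.ofReal ((n : ℝ) ^ n) * volume (solidSimplex n) :=
    volume_smul_solidSimplex hn0.le
  have hle : ENNReal.ofReal (Real.exp (-n)) * volume T ≤ 1 := by
    refine le_trans ?_ (prob_le_one (μ := expLawPi n) (s := T))
    rw [expLawPi_eq, withDensity_apply _ hTm, ← setLIntegral_const]
    refine setLIntegral_mono' hTm fun g hg => ENNReal.ofReal_le_ofReal ?_
    obtain ⟨v, hv, rfl⟩ := hg
    have hpos : ∀ i, 0 ≤ (n : ℝ) * v i := fun i => mul_nonneg hn0.le (hv.1 i)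
    have : ∏ i, expDensity (n * v i) = Real.exp (-∑ i, n * v i) := by
      rw [← Finset.sum_neg_distrib, Real.exp_sum]
      exact Finset.prod_congr rfl fun i _ => Set.indicator_of_mem (Set.mem_Ici.2 (hpos i)) _
    rw [this, ← Finset.mul_sum]
    refine Real.exp_le_exp.2 (neg_le_neg ?_)
    nlinarith [hv.2]
  rw [hvol, ← mul_assoc, ← ENNReal.ofReal_mul (Real.exp_pos _).le] at hle
  have hc : 0 < Real.exp (-n) * (n : ℝ) ^ n := by positivity
  calc volume (solidSimplex n) ≤ 1 / ENNReal.ofReal (Real.exp (-n) * (n : ℝ) ^ n) := by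
        rw [ENNReal.le_div_iff_mul_le (.inl (by simpa using hc)) (.inl ENNReal.ofReal_ne_top),
          mul_comm]
        exact hle
    _ = ENNReal.ofReal (Real.exp n * ((n : ℝ) ^ n)⁻¹) := by
        rw [one_div, ← ENNReal.ofReal_inv_of_pos hc, mul_inv, Real.exp_neg, inv_inv]

lemma expLaw_Icc_pos {s : ℝ} (hs : 0 < s) : 0 < expLaw (Set.Icc (1 - s) (1 + s)) := by
  have hsub : Set.Icc 1 (1 + s) ⊆ Set.Icc (1 - s) (1 + s) :=
    Set.Icc_subset_Icc_left (by linarith)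
  refine lt_of_lt_of_le ?_ (measure_mono hsub)
  rw [expLaw_eq, withDensity_apply _ measurableSet_Icc]
  have : ENNReal.ofReal (Real.exp (-(1 + s))) * volume (Set.Icc 1 (1 + s)) ≤
      ∫⁻ x in Set.Icc 1 (1 + s), ENNReal.ofReal (expDensity x) := by
    rw [← setLIntegral_const]
    refine setLIntegral_mono' measurableSet_Icc fun x hx => ENNReal.ofReal_le_ofReal ?_
    rw [expDensity, Set.indicator_of_mem (Set.mem_Ici.2 (zero_le_one.trans hx.1))]
    exact Real.exp_le_exp.2 (neg_le_neg hx.2)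
  refine lt_of_lt_of_le ?_ this
  rw [Real.volume_Icc, ← ENNReal.ofReal_mul (Real.exp_pos _).le]
  simp only [add_sub_cancel_left, ENNReal.ofReal_pos]
  positivity

/-! ### Concentration uniform in the number of variables -/

lemma expLawPi_chebyshev {n : ℕ} (c : Fin n → ℝ) {ε : ℝ} (hε : 0 < ε) :
    expLawPi n {g | ε ≤ |∑ i, c i * (g i - 1)|} ≤
      ENNReal.ofReal (2 * (∑ i, c i ^ 2) / ε ^ 2) := by
  have hmem : ∀ i, MemLp (fun x : ℝ => c i * x) 2 expLaw := fun i => memLp_id_expLaw.const_mul _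
  have hmemPi : MemLp (fun g : Fin n → ℝ => ∑ i, c i * g i) 2 (expLawPi n) :=
    memLp_finsetSum _ fun i _ =>
      (hmem i).comp_measurePreserving (measurePreserving_eval (fun _ : Fin n => expLaw) i)
  have hmean : ∫ g, ∑ i, c i * g i ∂(expLawPi n) = ∑ i, c i := by
    rw [integral_finsetSum]
    · refine Finset.sum_congr rfl fun i _ => ?_
      rw [expLawPi, integral_comp_eval (X := fun _ : Fin n => ℝ) (μ := fun _ : Fin n => expLaw) (i := i)
        (f := fun x : ℝ => c i * x) (by fun_prop),
        integral_const_mul]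
      have := integral_pow_expLaw 1
      simp only [pow_one, Nat.factorial_one, Nat.cast_one] at this
      rw [this, mul_one]
    · intro i _
      exact integrable_comp_eval (μ := fun _ : Fin n => expLaw) (f := fun x : ℝ => c i * x)
        ((hmem i).integrable one_le_two)
  have hvar : ProbabilityTheory.variance (fun g : Fin n → ℝ => ∑ i, c i * g i) (expLawPi n) ≤
      2 * ∑ i, c i ^ 2 := by
    have := ProbabilityTheory.variance_sum_pi (μ := fun _ : Fin n => expLaw) hmem
    rw [Finset.sum_fn] at this
    rw [expLawPi, this, Finset.mul_sum]
    refine Finset.sum_le_sum fun i _ => ?_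
    rw [ProbabilityTheory.variance_const_mul, mul_comm 2]
    exact mul_le_mul_of_nonneg_left variance_id_expLaw_le (sq_nonneg _)
  have := ProbabilityTheory.meas_ge_le_variance_div_sq hmemPi hε
  rw [hmean] at this
  simp only [mul_sub, mul_one, Finset.sum_sub_distrib]
  exact this.trans (ENNReal.ofReal_le_ofReal (by gcongr))

lemma expLawPi_inter_eq_mul {n : ℕ} (I J : Finset (Fin n)) (hIJ : Disjoint I J)
    {S : Set (I → ℝ)} {T : Set (J → ℝ)} (hS : MeasurableSet S) (hT : MeasurableSet T) :
    expLawPi n ((fun g (i : I) => g i) ⁻¹' S ∩ (fun g (i : J) => g i) ⁻¹' T) =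
      expLawPi n ((fun g (i : I) => g i) ⁻¹' S) * expLawPi n ((fun g (i : J) => g i) ⁻¹' T) := by
  have hind : ProbabilityTheory.iIndepFun (fun (i : Fin n) (g : Fin n → ℝ) => g i) (expLawPi n) :=
    ProbabilityTheory.iIndepFun_pi (μ := fun _ : Fin n => expLaw) (X := fun _ x => x)
      fun _ => aemeasurable_id
  exact (hind.indepFun_finset I J hIJ fun i => measurable_pi_apply i).measure_inter_preimage_eq_mul
    S T hS hT

/-- Linear combinations of independent centred exponential variables, with coefficients bounded
in `ℓ¹`, are small with a probability that does not depend on the number of variables. -/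
lemma exists_le_expLawPi (k : ℕ) (K : ℝ) {κ : ℝ} (hκ : 0 < κ) :
    ∃ q : ℝ, 0 < q ∧ ∀ (n : ℕ) (c : Fin k → Fin n → ℝ), (∀ j, ∑ i, |c j i| ≤ K) →
      ENNReal.ofReal q ≤ expLawPi n {g | ∀ j, |∑ i, c j i * (g i - 1)| ≤ κ} := by
  set K' : ℝ := |k * K| + 1 with hK'
  have hK'0 : 0 < K' := by positivity
  -- Coordinates with total coefficient above `θ` number at most `K' / θ` and are confined to `[1 -
  -- s, 1 + s]`, at cost `P ^ N`. The others are handled by Chebyshev: `θ` makes the failure bound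
  -- `1 / 2`, and `s` satisfies `K' * s = κ / 2`.
  set θ : ℝ := κ ^ 2 / (16 * K') with hθ
  have hθ0 : 0 < θ := by positivity
  set s : ℝ := κ / (2 * K') with hs
  have hs0 : 0 < s := by positivity
  set P := expLaw (Set.Icc (1 - s) (1 + s)) with hP
  have hP0 : 0 < P := expLaw_Icc_pos hs0
  have hP1 : P ≤ 1 := prob_le_one
  set N := ⌊K' / θ⌋₊ with hN
  have hPN : P ^ N * 2⁻¹ ≠ 0 := mul_ne_zero (pow_ne_zero _ hP0.ne') (by simp)
  have hPN' : P ^ N * 2⁻¹ ≠ ∞ :=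
    ENNReal.mul_ne_top (ENNReal.pow_ne_top (hP1.trans_lt ENNReal.one_lt_top).ne) (by simp)
  refine ⟨(P ^ N * 2⁻¹).toReal, ENNReal.toReal_pos hPN hPN', fun n c hc => ?_⟩
  rw [ENNReal.ofReal_toReal hPN']
  set d : Fin n → ℝ := fun i => ∑ j, |c j i| with hd
  have hd0 : ∀ i, 0 ≤ d i := fun i => Finset.sum_nonneg fun j _ => abs_nonneg _
  have hcd : ∀ j i, |c j i| ≤ d i := fun j i =>
    Finset.single_le_sum (f := fun j => |c j i|) (fun _ _ => abs_nonneg _) (Finset.mem_univ j)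
  have hdsum : ∑ i, d i ≤ K' := by
    rw [hd, Finset.sum_comm]
    calc ∑ j, ∑ i, |c j i| ≤ ∑ _j : Fin k, K := Finset.sum_le_sum fun j _ => hc j
      _ = k * K := by simp
      _ ≤ K' := by rw [hK']; linarith [le_abs_self (k * K)]
  set I : Finset (Fin n) := Finset.univ.filter fun i => θ < d i with hI
  have hIcard : I.card ≤ N := by
    refine Nat.le_floor ?_
    rw [le_div_iff₀ hθ0]
    calc (I.card : ℝ) * θ = ∑ _i ∈ I, θ := by simp
      _ ≤ ∑ i ∈ I, d i := Finset.sum_le_sum fun i hi => (Finset.mem_filter.1 hi).2.le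
      _ ≤ ∑ i, d i := Finset.sum_le_sum_of_subset_of_nonneg (Finset.subset_univ _)
          fun i _ _ => hd0 i
      _ ≤ K' := hdsum
  let S₁ : Set (I → ℝ) := Set.univ.pi fun _ => Set.Icc (1 - s) (1 + s)
  let S₂ : Set (↥(Iᶜ) → ℝ) := {z | ∀ j, |∑ i : ↥(Iᶜ), c j i * (z i - 1)| < κ / 2}
  have hS₁ : MeasurableSet S₁ := MeasurableSet.univ_pi fun _ => measurableSet_Icc
  have hS₂ : MeasurableSet S₂ := by
    simp only [S₂, Set.ofPred_forall]
    exact MeasurableSet.iInter fun j => measurableSet_lt (by fun_prop) measurable_const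
  have hprob₁ : P ^ N ≤ expLawPi n ((fun g (i : I) => g i) ⁻¹' S₁) := by
    have : (fun (g : Fin n → ℝ) (i : I) => g i) ⁻¹' S₁ =
        Set.univ.pi fun i => if i ∈ I then Set.Icc (1 - s) (1 + s) else Set.univ := by
      ext g
      simp only [S₁, Set.mem_preimage, Set.mem_pi, Set.mem_univ, true_implies, Subtype.forall]
      exact forall_congr' fun i => by by_cases hi : i ∈ I <;> simp [hi]
    rw [this, expLawPi, Measure.pi_pi]
    have hterm : ∀ i, expLaw (if i ∈ I then Set.Icc (1 - s) (1 + s) else Set.univ) =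
        if i ∈ I then P else 1 := fun i => by by_cases hi : i ∈ I <;> simp [hi, hP]
    simp only [hterm, Finset.prod_ite_mem, Finset.univ_inter, Finset.prod_const]
    exact pow_le_pow_right_of_le_one' hP1 hIcard
  have hprob₂ : 2⁻¹ ≤ expLawPi n ((fun g (i : ↥(Iᶜ)) => g i) ⁻¹' S₂) := by
    -- Zeroing the large coefficients gives `∑ c' ^ 2 ≤ θ K'`, with no dependence on `n`.
    set c' : Fin k → Fin n → ℝ := fun j i => if i ∈ I then 0 else c j i with hc'
    have hsum : ∀ (g : Fin n → ℝ) (j : Fin k),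
        ∑ i : ↥(Iᶜ), c j i * (g i - 1) = ∑ i, c' j i * (g i - 1) := by
      intro g j
      rw [Finset.sum_coe_sort Iᶜ fun i => c j i * (g i - 1)]
      simp only [hc', ite_mul, zero_mul]
      rw [Finset.sum_ite, Finset.sum_const_zero, zero_add]
      exact Finset.sum_congr (by ext i; simp) fun _ _ => rfl
    have hmeas : MeasurableSet ((fun (g : Fin n → ℝ) (i : ↥(Iᶜ)) => g i) ⁻¹' S₂) :=
      hS₂.preimage (by fun_prop)
    have hcompl : expLawPi n ((fun (g : Fin n → ℝ) (i : ↥(Iᶜ)) => g i) ⁻¹' S₂)ᶜ ≤ 2⁻¹ := by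
      have hsub : ((fun (g : Fin n → ℝ) (i : ↥(Iᶜ)) => g i) ⁻¹' S₂)ᶜ ⊆
          ⋃ j, {g | κ / 2 ≤ |∑ i, c' j i * (g i - 1)|} := by
        intro g hg
        simp only [S₂, Set.mem_compl_iff, Set.mem_preimage, Set.mem_ofPred_eq, not_forall,
          not_lt, hsum] at hg
        exact Set.mem_iUnion.2 hg
      have hsq : ∑ j, ∑ i, c' j i ^ 2 ≤ θ * K' := by
        rw [Finset.sum_comm]
        calc ∑ i, ∑ j, c' j i ^ 2 ≤ ∑ i, θ * d i := by
              refine Finset.sum_le_sum fun i _ => ?_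
              rw [hd, Finset.mul_sum]
              refine Finset.sum_le_sum fun j _ => ?_
              by_cases hi : i ∈ I
              · rw [show c' j i = 0 from if_pos hi, sq, zero_mul]
                positivity
              · simp only [hc', hi, if_false]
                have hi' : d i ≤ θ := by simpa [hI] using hi
                rw [← sq_abs, sq]
                exact mul_le_mul_of_nonneg_right ((hcd j i).trans hi') (abs_nonneg _)
          _ = θ * ∑ i, d i := by rw [Finset.mul_sum]
          _ ≤ θ * K' := by gcongr
      calc _ ≤ ∑ j, expLawPi n {g | κ / 2 ≤ |∑ i, c' j i * (g i - 1)|} :=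
            (measure_mono hsub).trans (measure_iUnion_fintype_le _ _)
        _ ≤ ∑ j, ENNReal.ofReal (2 * (∑ i, c' j i ^ 2) / (κ / 2) ^ 2) :=
            Finset.sum_le_sum fun j _ => expLawPi_chebyshev _ (by positivity)
        _ = ENNReal.ofReal (2 * (∑ j, ∑ i, c' j i ^ 2) / (κ / 2) ^ 2) := by
            rw [← ENNReal.ofReal_sum_of_nonneg fun j _ => by positivity, Finset.mul_sum,
              Finset.sum_div]
        _ ≤ ENNReal.ofReal (2 * (θ * K') / (κ / 2) ^ 2) :=
            ENNReal.ofReal_le_ofReal (by gcongr)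
        _ = 2⁻¹ := by
            have : 2 * (θ * K') / (κ / 2) ^ 2 = 2⁻¹ := by rw [hθ]; field_simp; norm_num
            rw [this, ENNReal.ofReal_inv_of_pos two_pos, ENNReal.ofReal_ofNat]
    have hadd := prob_add_prob_compl (μ := expLawPi n) hmeas
    by_contra! hlt
    have := ENNReal.add_lt_add_of_lt_of_le (hcompl.trans_lt (by simp)).ne hlt hcompl
    rw [hadd, ENNReal.inv_two_add_inv_two] at this
    exact lt_irrefl _ this
  calc P ^ N * 2⁻¹ ≤ expLawPi n ((fun g (i : I) => g i) ⁻¹' S₁) *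
        expLawPi n ((fun g (i : ↥(Iᶜ)) => g i) ⁻¹' S₂) := mul_le_mul' hprob₁ hprob₂
    _ = _ := (expLawPi_inter_eq_mul I Iᶜ disjoint_compl_right hS₁ hS₂).symm
    _ ≤ _ := measure_mono ?_
  rintro g ⟨h1, h2⟩ j
  have hsplit := Finset.sum_add_sum_compl I fun i => c j i * (g i - 1)
  have h2' : |∑ i ∈ Iᶜ, c j i * (g i - 1)| < κ / 2 := by
    rw [← Finset.sum_coe_sort Iᶜ fun i => c j i * (g i - 1)]
    exact h2 j
  have h1' : |∑ i ∈ I, c j i * (g i - 1)| ≤ κ / 2 := by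
    calc |∑ i ∈ I, c j i * (g i - 1)| ≤ ∑ i ∈ I, |c j i * (g i - 1)| :=
          Finset.abs_sum_le_sum_abs _ _
      _ ≤ ∑ i ∈ I, d i * s := by
          refine Finset.sum_le_sum fun i hi => ?_
          rw [abs_mul]
          have hgi := h1 ⟨i, hi⟩ trivial
          refine mul_le_mul (hcd j i) ?_ (abs_nonneg _) (hd0 i)
          rw [abs_le]
          exact ⟨by linarith [hgi.1], by linarith [hgi.2]⟩
      _ ≤ ∑ i, d i * s := Finset.sum_le_sum_of_subset_of_nonneg (Finset.subset_univ _)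
          fun i _ _ => mul_nonneg (hd0 i) hs0.le
      _ = (∑ i, d i) * s := by rw [Finset.sum_mul]
      _ ≤ K' * s := by gcongr
      _ = κ / 2 := by rw [hs]; field_simp
  rw [← hsplit]
  exact (abs_add_le _ _).trans (by linarith)

/-! ### The lower bound for large `n` -/

lemma sum_mul_moment_le (hγ : 0 < γ) {n : ℕ}
    {Y u : Fin n → ℝ} (hu0 : ∀ i, 0 ≤ u i) {y : ℝ}
    (hu : ∑ i, u i * (h |Y i| - B) + (1 - ∑ i, u i) * (h y - γ - B) ≤ 0) :
    ∑ i, u i * h |Y i| + (1 - ∑ i, u i) * h y ≤ B + γ := by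
  have hs0 := Finset.sum_nonneg fun i (_ : i ∈ Finset.univ) => hu0 i
  simp only [mul_sub, Finset.sum_sub_distrib, ← Finset.sum_mul] at hu
  nlinarith

/-- Moving a point of the crossing set towards the vertex of the additional support point creates
enough slack to rescale its coordinates by factors that are close to one on average. -/
lemma perturbation_mem (hh : IsMomentFunction h) (hB : 0 < B) (hγ : 0 < γ) {t y₀ : ℝ}
    (ht0 : 0 < t) (ht1 : t < 1) (hy₀ : 0 < y₀) (hhy₀ : h y₀ ≤ B / 2) {n : ℕ} {Y u : Fin n → ℝ}
    (hu : u ∈ crossingSet h B γ Y) (hu0 : ∀ i, 0 ≤ u i) (hus : ∑ i, u i ≤ 1) {κ : ℝ}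
    (hκ0 : 0 ≤ κ) (hκt : κ ≤ t) (hκ1 : κ * (1 + (1 + (B + γ) / t / h 1)) ≤ t * y₀)
    (hκ2 : κ * (1 + ((B + γ) / t + (γ + B))) ≤ t * (B / 2)) {g : Fin n → ℝ}
    (hg : ∀ i, 0 ≤ g i) (hg1 : |∑ i, (1 - t) * u i * (g i - 1)| ≤ κ)
    (hg2 : |∑ i, (1 - t) * u i * Y i * (g i - 1)| ≤ κ)
    (hg3 : |∑ i, (1 - t) * u i * (h |Y i| - B) * (g i - 1)| ≤ κ) :
    (fun i => (1 - t) * u i * g i) ∈ crossingSet h B γ Y ∩ solidSimplex n := by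
  obtain ⟨y, hy, hc1, hc2⟩ := hu
  have hbound := sum_mul_moment_le hγ hu0 hc2
  have h1 := hh.pos 1 one_pos
  have hw : 0 ≤ 1 - ∑ i, u i := sub_nonneg.2 hus
  -- The old extra point `y` and the added mass `t` at `y₀` are merged into the single point `z`.
  obtain ⟨z, hz, hz1, hz2⟩ := hh.exists_perspective
    (mul_nonneg (sub_nonneg.2 ht1.le) hw) ht0.le hy hy₀.le
  set W := (1 - t) * (1 - ∑ i, u i) + t with hW
  have hWt : t ≤ W := by
    have := mul_nonneg (sub_nonneg.2 ht1.le) hw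
    linarith
  have hmom : 0 ≤ ∑ i, u i * h |Y i| :=
    Finset.sum_nonneg fun i _ => mul_nonneg (hu0 i) (hh.nonneg (abs_nonneg _))
  -- The merged mass `W` is at least `t`, which bounds `z` independently of `y` and of the
  -- observations.
  have hhz : h z ≤ (B + γ) / t := by
    rw [le_div_iff₀ ht0]
    have e1 : h z * t ≤ W * h z := by rw [mul_comm]; gcongr; exact hh.nonneg hz
    have e2 : (1 - t) * ((1 - ∑ i, u i) * h y) ≤ (1 - t) * (B + γ) := by
      gcongr
      linarith
    have e3 : t * h y₀ ≤ t * (B + γ) := by gcongr; linarith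
    linarith
  have hzle : z ≤ 1 + (B + γ) / t / h 1 := (hh.le_one_add_div hz).trans (by gcongr)
  have hhz0 := hh.nonneg hz
  have hexp : ∀ f : Fin n → ℝ, ∑ i, (1 - t) * u i * g i * f i =
      (1 - t) * ∑ i, u i * f i + ∑ i, (1 - t) * u i * f i * (g i - 1) := by
    intro f
    rw [Finset.mul_sum, ← Finset.sum_add_distrib]
    exact Finset.sum_congr rfl fun i _ => by ring
  have hexp1 := hexp 1
  simp only [Pi.one_apply, mul_one] at hexp1
  set ρ := ∑ i, (1 - t) * u i * (g i - 1) with hρ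
  obtain ⟨hg1a, hg1b⟩ := abs_le.1 hg1
  have hlast : 1 - ∑ i, (1 - t) * u i * g i = W - ρ := by rw [hexp1]; ring
  refine ⟨⟨z, hz, ?_, ?_⟩, fun i => ?_, ?_⟩
  -- The mass at `y₀` gains `t * y₀` in the first constraint and at least `t * (B / 2)` in the
  -- second. These gains absorb the fluctuation and the mass `ρ` taken from the last weight.
  · rw [hlast, hexp, sub_mul W, hz1]
    have e1 := mul_nonneg (sub_nonneg.2 ht1.le) hc1
    have e2 : ρ * z ≤ κ * (1 + (B + γ) / t / h 1) :=
      (mul_le_mul_of_nonneg_right hg1b hz).trans (mul_le_mul_of_nonneg_left hzle hκ0)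
    linarith [(abs_le.1 hg2).1]
  · rw [hlast, hexp fun i => h |Y i| - B]
    have e1 := mul_nonpos_of_nonneg_of_nonpos (sub_nonneg.2 ht1.le) hc2
    have e2 : |h z - γ - B| ≤ (B + γ) / t + (γ + B) := by
      rw [abs_le]
      have : 0 ≤ (B + γ) / t := by positivity
      constructor <;> linarith
    have e3 : -(ρ * (h z - γ - B)) ≤ κ * ((B + γ) / t + (γ + B)) := by
      refine (neg_le_abs _).trans ?_
      rw [abs_mul]
      exact mul_le_mul hg1 e2 (abs_nonneg _) hκ0
    have e4 : W * (h z - γ - B) ≤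
        (1 - t) * ((1 - ∑ i, u i) * (h y - γ - B)) + t * (h y₀ - γ - B) := by
      have : W * (γ + B) = (1 - t) * (1 - ∑ i, u i) * (γ + B) + t * (γ + B) := by rw [hW]; ring
      linarith
    have e5 : t * (h y₀ - γ - B) ≤ -(t * (B / 2)) := by
      have := mul_le_mul_of_nonneg_left hhy₀ ht0.le
      have := mul_pos ht0 hγ
      linarith
    linarith [(abs_le.1 hg3).2]
  · exact mul_nonneg (mul_nonneg (sub_nonneg.2 ht1.le) (hu0 i)) (hg i)
  · show ∑ i, (1 - t) * u i * g i ≤ 1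
    linarith

lemma ae_nonneg_expLawPi (n : ℕ) : ∀ᵐ g ∂(expLawPi n), ∀ i, 0 ≤ g i := by
  rw [ae_all_iff]
  intro i
  have h0 : ∀ᵐ x ∂expLaw, 0 ≤ x := by
    rw [expLaw_eq, ae_withDensity_iff measurable_expDensity.ennreal_ofReal]
    refine .of_forall fun x hx => ?_
    by_contra hlt
    exact hx (by simp [expDensity, hlt])
  exact (measurePreserving_eval (fun _ : Fin n => expLaw) i).quasiMeasurePreserving.ae h0

/-- The lower bound that is uniform in the observations. -/
lemma exists_le_bcp (hh : IsMomentFunction h) (hB : 0 < B) (hγ : 0 < γ) {δ : ℝ} (hδ : 0 < δ) :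
    ∃ n₀ : ℕ, ∀ n : ℕ, 1 ≤ n → n₀ ≤ n → ∀ (X : Fin n → ℝ) (μ : ℝ),
      Real.exp (-(n * (lambdaStar h B 0 γ (empirical X) μ + δ))) ≤ bcp h B γ μ X := by
  obtain ⟨y₀, hy₀, hhy₀⟩ := hh.exists_pos_le (half_pos hB)
  have h1 := hh.pos 1 one_pos
  -- The loss `δ` is split into quarters: strong duality, the contraction `(1 - t) ^ n`, the density
  -- error `κ`, and the constant `q`, absorbed once `n ≥ n₀`.
  set t := 1 - Real.exp (-(δ / 4)) with ht
  have h1t : 1 - t = Real.exp (-(δ / 4)) := by rw [ht]; ring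
  have ht0 : 0 < t := by
    rw [ht, sub_pos, Real.exp_lt_one_iff]
    linarith
  have ht1 : t < 1 := by linarith [Real.exp_pos (-(δ / 4))]
  set M₁ := 1 + (1 + (B + γ) / t / h 1) with hM₁
  set M₂ := 1 + ((B + γ) / t + (γ + B)) with hM₂
  have hM₁0 : 0 < M₁ := by positivity
  have hM₂0 : 0 < M₂ := by positivity
  set κ := min (min (δ / 4) t) (min (t * y₀ / M₁) (t * (B / 2) / M₂)) with hκ
  have hκ0 : 0 < κ := by positivity
  have hκδ : κ ≤ δ / 4 := (min_le_left _ _).trans (min_le_left _ _)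
  have hκt : κ ≤ t := (min_le_left _ _).trans (min_le_right _ _)
  have hκ1 : κ * M₁ ≤ t * y₀ := by
    rw [← le_div_iff₀ hM₁0]; exact (min_le_right _ _).trans (min_le_left _ _)
  have hκ2 : κ * M₂ ≤ t * (B / 2) := by
    rw [← le_div_iff₀ hM₂0]; exact (min_le_right _ _).trans (min_le_right _ _)
  set K := 1 + (B + γ) / h 1 + (B + γ) + B with hK
  have hBγ : 0 ≤ (B + γ) / h 1 := by positivity
  obtain ⟨q, hq, hconc⟩ := exists_le_expLawPi 4 K hκ0
  obtain ⟨n₀, hn₀⟩ := exists_nat_ge (-Real.log q / (δ / 4))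
  refine ⟨n₀, fun n hn hnn X μ => ?_⟩
  have hn0 : (0 : ℝ) < n := by exact_mod_cast hn
  have hqn : Real.exp (-(n * (δ / 4))) ≤ q := by
    rw [← Real.le_log_iff_exp_le hq]
    have : -Real.log q / (δ / 4) ≤ n := hn₀.trans (by exact_mod_cast hnn)
    rw [div_le_iff₀ (by positivity)] at this
    linarith
  set Λ := lambdaStar h B 0 γ (empirical X) μ with hΛ
  set Y : Fin n → ℝ := fun i => X i - μ with hY
  obtain ⟨u, hu, hu0, hus, hprod⟩ := exists_mem_crossingSet hh hB hγ hn X μ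
    (by positivity : 0 < δ / 4)
  have hu0' : ∀ i, 0 ≤ u i := fun i => (hu0 i).le
  set p : Fin n → ℝ := fun i => (1 - t) * u i with hp
  have hp0 : ∀ i, 0 < p i := fun i => mul_pos (sub_pos.2 ht1) (hu0 i)
  have hpu : ∀ i, p i ≤ u i := fun i => by
    have := mul_nonneg ht0.le (hu0' i)
    simp only [hp]
    linarith
  have hmom : ∑ i, u i * h |Y i| ≤ B + γ := by
    obtain ⟨y, hy, -, hc2⟩ := hu
    have := sum_mul_moment_le hγ hu0' hc2
    have := mul_nonneg (sub_nonneg.2 hus) (hh.nonneg hy)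
    linarith
  -- The first three rows control mass, mean and moment in `perturbation_mem`. The last keeps `∑ g i
  -- ≥ n (1 - κ)`, which turns probability into volume.
  let c : Fin 4 → Fin n → ℝ :=
    ![fun i => p i, fun i => p i * Y i, fun i => p i * (h |Y i| - B), fun _ => (n : ℝ)⁻¹]
  have hcK : ∀ j, ∑ i, |c j i| ≤ K := by
    have e0 : ∑ i, |p i| ≤ K := by
      calc ∑ i, |p i| ≤ ∑ i, u i :=
            Finset.sum_le_sum fun i _ => by rw [abs_of_pos (hp0 i)]; exact hpu i
        _ ≤ K := by rw [hK]; linarith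
    have e1 : ∑ i, |p i * Y i| ≤ K := by
      calc ∑ i, |p i * Y i| ≤ ∑ i, (u i + u i * h |Y i| / h 1) := by
            refine Finset.sum_le_sum fun i _ => ?_
            rw [abs_mul, abs_of_pos (hp0 i)]
            calc p i * |Y i| ≤ u i * (1 + h |Y i| / h 1) :=
                  mul_le_mul (hpu i) (hh.le_one_add_div (abs_nonneg _)) (abs_nonneg _) (hu0' i)
              _ = _ := by ring
        _ = ∑ i, u i + (∑ i, u i * h |Y i|) / h 1 := by
            rw [Finset.sum_add_distrib, Finset.sum_div]
        _ ≤ 1 + (B + γ) / h 1 := by gcongr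
        _ ≤ K := by rw [hK]; linarith
    have e2 : ∑ i, |p i * (h |Y i| - B)| ≤ K := by
      calc ∑ i, |p i * (h |Y i| - B)| ≤ ∑ i, (u i * h |Y i| + u i * B) := by
            refine Finset.sum_le_sum fun i _ => ?_
            rw [abs_mul, abs_of_pos (hp0 i), ← mul_add]
            refine mul_le_mul (hpu i) ?_ (abs_nonneg _) (hu0' i)
            have := hh.nonneg (abs_nonneg (Y i))
            rw [abs_le]
            constructor <;> linarith
        _ = ∑ i, u i * h |Y i| + (∑ i, u i) * B := by
            rw [Finset.sum_add_distrib, Finset.sum_mul]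
        _ ≤ (B + γ) + 1 * B := by gcongr
        _ ≤ K := by rw [hK]; linarith
    have e3 : ∑ _i : Fin n, |(n : ℝ)⁻¹| ≤ K := by
      rw [Finset.sum_const, Finset.card_univ, Fintype.card_fin, nsmul_eq_mul,
        abs_of_pos (inv_pos.2 hn0), mul_inv_cancel₀ hn0.ne', hK]
      linarith
    intro j
    fin_cases j
    exacts [e0, e1, e2, e3]
  set T : Set (Fin n → ℝ) := {g | (∀ i, 0 ≤ g i) ∧ ∀ j, |∑ i, c j i * (g i - 1)| ≤ κ} with hT
  have hTm : MeasurableSet T := by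
    simp only [hT, Set.ofPred_and, Set.ofPred_forall]
    exact (MeasurableSet.iInter fun i => measurableSet_le measurable_const (by fun_prop)).inter
      (MeasurableSet.iInter fun j => measurableSet_le (by fun_prop) measurable_const)
  have hqT : ENNReal.ofReal q ≤ expLawPi n T :=
    (hconc n c hcK).trans <| measure_mono_ae <| by
      filter_upwards [ae_nonneg_expLawPi n] with g hg hg'
      exact ⟨hg, hg'⟩
  have hsumT : ∀ g ∈ T, n * (1 - κ) ≤ ∑ i, g i := by
    intro g hg
    have h3 : |∑ i, (n : ℝ)⁻¹ * (g i - 1)| ≤ κ := hg.2 3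
    rw [← Finset.mul_sum, Finset.sum_sub_distrib] at h3
    have h4 := (abs_le.1 h3).1
    rw [← div_eq_inv_mul, le_div_iff₀ hn0] at h4
    simp only [Finset.sum_const, Finset.card_univ, Fintype.card_fin, nsmul_eq_mul, mul_one] at h4
    linarith
  have hvolT : ENNReal.ofReal (q * Real.exp (n * (1 - κ))) ≤ volume T := by
    have := hqT.trans (expLawPi_le_volume hTm hsumT)
    rw [mul_comm, ENNReal.ofReal_mul (Real.exp_pos _).le]
    calc _ ≤ ENNReal.ofReal (Real.exp (n * (1 - κ))) *
          (ENNReal.ofReal (Real.exp (-(n * (1 - κ)))) * volume T) := by gcongr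
      _ = volume T := by
          rw [← mul_assoc, ← ENNReal.ofReal_mul (Real.exp_pos _).le, ← Real.exp_add,
            add_neg_cancel, Real.exp_zero, ENNReal.ofReal_one, one_mul]
  have hmemA : ∀ v ∈ (fun (v : Fin n → ℝ) i => (p i)⁻¹ * v i) ⁻¹' T,
      v ∈ crossingSet h B γ Y ∩ solidSimplex n := by
    intro v hv
    obtain ⟨hv0, hvj⟩ := hv
    have := perturbation_mem hh hB hγ ht0 ht1 hy₀ hhy₀ hu hu0' hus hκ0.le hκt hκ1 hκ2 hv0
      (hvj 0) (hvj 1) (hvj 2)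
    have hveq : (fun i => (1 - t) * u i * ((p i)⁻¹ * v i)) = v :=
      funext fun i => mul_inv_cancel_left₀ (hp0 i).ne' (v i)
    rwa [hveq] at this
  refine le_bcp (fun v hv => (hmemA v hv).1) (fun v hv => (hmemA v hv).2) ?_
  rw [volume_preimage_mul _ fun i => inv_pos.2 (hp0 i), Finset.prod_inv_distrib, inv_inv]
  have hprodp : ∏ i, p i = Real.exp (-(n * (δ / 4))) * ((n : ℝ) ^ n)⁻¹ * ∏ i, n * u i := by
    simp only [hp, Finset.prod_mul_distrib, Finset.prod_const, Finset.card_univ, Fintype.card_fin]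
    rw [h1t, ← Real.exp_nat_mul, mul_neg]
    field_simp
  have hreal : Real.exp (-(n * (Λ + δ))) * (Real.exp n * ((n : ℝ) ^ n)⁻¹) ≤
      (∏ i, p i) * (q * Real.exp (n * (1 - κ))) := by
    have hexp : Real.exp (-(n * (Λ + δ))) * Real.exp n ≤
        Real.exp (-(n * (δ / 4))) * Real.exp (-(n * (Λ + δ / 4))) *
          (Real.exp (-(n * (δ / 4))) * Real.exp (n * (1 - κ))) := by
      simp only [← Real.exp_add]
      refine Real.exp_le_exp.2 ?_
      have := mul_le_mul_of_nonneg_left hκδ hn0.le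
      linarith
    calc Real.exp (-(n * (Λ + δ))) * (Real.exp n * ((n : ℝ) ^ n)⁻¹)
        = Real.exp (-(n * (Λ + δ))) * Real.exp n * ((n : ℝ) ^ n)⁻¹ := by ring
      _ ≤ Real.exp (-(n * (δ / 4))) * Real.exp (-(n * (Λ + δ / 4))) *
          (Real.exp (-(n * (δ / 4))) * Real.exp (n * (1 - κ))) * ((n : ℝ) ^ n)⁻¹ := by gcongr
      _ = Real.exp (-(n * (δ / 4))) * ((n : ℝ) ^ n)⁻¹ * Real.exp (-(n * (Λ + δ / 4))) *
          (Real.exp (-(n * (δ / 4))) * Real.exp (n * (1 - κ))) := by ring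
      _ ≤ Real.exp (-(n * (δ / 4))) * ((n : ℝ) ^ n)⁻¹ * (∏ i, n * u i) *
          (q * Real.exp (n * (1 - κ))) := by
          gcongr
          exact mul_nonneg (by positivity)
            (Finset.prod_nonneg fun i _ => mul_nonneg hn0.le (hu0' i))
      _ = _ := by rw [hprodp]
  calc ENNReal.ofReal (Real.exp (-(n * (Λ + δ)))) * volume (solidSimplex n)
      ≤ ENNReal.ofReal (Real.exp (-(n * (Λ + δ)))) *
        ENNReal.ofReal (Real.exp n * ((n : ℝ) ^ n)⁻¹) := by
        gcongr; exact volume_solidSimplex_le hn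
    _ = ENNReal.ofReal (Real.exp (-(n * (Λ + δ))) * (Real.exp n * ((n : ℝ) ^ n)⁻¹)) :=
        (ENNReal.ofReal_mul (Real.exp_pos _).le).symm
    _ ≤ ENNReal.ofReal ((∏ i, p i) * (q * Real.exp (n * (1 - κ)))) :=
        ENNReal.ofReal_le_ofReal hreal
    _ = ENNReal.ofReal (∏ i, p i) * ENNReal.ofReal (q * Real.exp (n * (1 - κ))) :=
        ENNReal.ofReal_mul (Finset.prod_nonneg fun i _ => (hp0 i).le)
    _ ≤ ENNReal.ofReal (∏ i, p i) * volume T := by gcongr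

/-! ### The prefactor and the conclusion -/

/-- The exponential upper bound holds with prefactor `1`, so any function at least `1` of the
required order serves, here one independent of `F`. -/
lemma jointlyContinuous_one_add_inv_sq :
    JointlyContinuous fun _ η => 1 + (η ^ 2)⁻¹ := by
  intro F _ η hη ε hε
  have hc : ContinuousAt (fun η : ℝ => 1 + (η ^ 2)⁻¹) η :=
    continuousAt_const.add ((continuousAt_id.pow 2).inv₀ (by simpa using hη.ne'))
  obtain ⟨ρ, hρ, hlt⟩ := Metric.continuousAt_iff.1 hc ε hε
  exact ⟨ρ, hρ, fun G _ η' _ _ hη' => hlt hη'⟩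

lemma one_add_inv_sq_isTheta :
    (fun η : ℝ => 1 + (η ^ 2)⁻¹) =Θ[𝓝[>] 0] fun η : ℝ => (η ^ 2)⁻¹ := by
  constructor
  · refine IsBigO.of_bound 2 ?_
    have hnhds : Set.Ioo (0 : ℝ) 1 ∈ 𝓝[>] (0 : ℝ) := Ioo_mem_nhdsGT one_pos
    filter_upwards [hnhds] with η hη
    have hη0 : 0 < η ^ 2 := pow_pos hη.1 2
    have hη2 : 1 ≤ (η ^ 2)⁻¹ := (one_le_inv₀ hη0).2 (pow_le_one₀ hη.1.le hη.2.le)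
    rw [Real.norm_of_nonneg (by positivity), Real.norm_of_nonneg (by positivity)]
    linarith
  · refine IsBigO.of_bound 1 (.of_forall fun η => ?_)
    rw [Real.norm_of_nonneg (by positivity), Real.norm_of_nonneg (by positivity)]
    linarith

end HNPTS

theorem mainTheorem5 (h : ℝ → ℝ) (hh : HNPTS.IsMomentFunction h) (B : ℝ) (hB : 0 < B) :
    -- the maximum defining `Λ*_{η,γ}(F_n, μ)` is attained, for all `η ≥ 0`
    (∀ γ : ℝ, 0 < γ → ∀ η : ℝ, 0 ≤ η → ∀ n : ℕ, 1 ≤ n → ∀ (X : Fin n → ℝ) (μ : ℝ),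
      IsGreatest
        (HNPTS.dualObjective h B (HNPTS.empirical X) μ '' HNPTS.dualSet h B η γ μ)
        (HNPTS.lambdaStar h B η γ (HNPTS.empirical X) μ)) ∧
    -- upper bound
    (∀ γ : ℝ, 0 < γ → ∃ C : Measure ℝ → ℝ → ℝ,
      HNPTS.JointlyContinuous C ∧
      (∀ F, HNPTS.FiniteMean F → (fun η : ℝ => C F η) =Θ[𝓝[>] 0] (fun η : ℝ => (η ^ 2)⁻¹)) ∧
      ∀ η : ℝ, 0 < η → ∀ n : ℕ, 1 ≤ n → ∀ (X : Fin n → ℝ) (μ : ℝ),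
        ∫ x, x ∂(HNPTS.empirical X) < μ →
        HNPTS.bcp h B γ μ X ≤
          C (HNPTS.empirical X) η *
            Real.exp (-(n * HNPTS.lambdaStar h B η γ (HNPTS.empirical X) μ))) ∧
    -- lower bound for large `n`
    (∀ δ : ℝ, 0 < δ → ∃ c : ℝ, 0 < c ∧ ∀ γ : ℝ, 0 < γ → ∃ n₀ : ℕ,
      ∀ n : ℕ, 1 ≤ n → n₀ ≤ n → ∀ (X : Fin n → ℝ) (μ : ℝ),
        ∫ x, x ∂(HNPTS.empirical X) < μ →
        c * Real.exp (-(n * (HNPTS.lambdaStar h B 0 γ (HNPTS.empirical X) μ + δ))) ≤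
          HNPTS.bcp h B γ μ X) ∧
    -- lower bound for every `n`, used for small `n`
    (∀ γ : ℝ, 0 < γ → ∀ n : ℕ, 1 ≤ n → ∀ (X : Fin n → ℝ) (μ : ℝ),
      ∫ x, x ∂(HNPTS.empirical X) < μ →
      |μ| < HNPTS.hInv h B →
      ∫ x, h |x - μ| ∂(HNPTS.empirical X) ≤ B →
      Real.exp (-(n * Real.log (n * HNPTS.constCB h B μ))) ≤ HNPTS.bcp h B γ μ X) := by
  refine ⟨fun γ hγ η hη n _ X μ => HNPTS.isGreatest_lambdaStar hh hB hγ hη X μ,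
    fun γ hγ => ⟨fun _ η => 1 + (η ^ 2)⁻¹, HNPTS.jointlyContinuous_one_add_inv_sq,
      fun _ _ => HNPTS.one_add_inv_sq_isTheta, fun η hη n hn X μ _ => ?_⟩,
    -- The constant is `1` because `n₀`, which may depend on `γ`, already absorbs the probability
    -- `q`.
    fun δ hδ => ⟨1, one_pos, fun γ hγ => ?_⟩,
    fun γ hγ n hn X μ _ hμ hF => HNPTS.pow_le_bcp hh hB hγ hn X μ hμ hF⟩
  · refine (HNPTS.bcp_le_exp_lambdaStar hh hB hγ hη.le hn X μ).trans
      (le_mul_of_one_le_left (Real.exp_pos _).le ?_)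
    have : 0 ≤ (η ^ 2)⁻¹ := by positivity
    linarith
  · obtain ⟨n₀, hn₀⟩ := HNPTS.exists_le_bcp hh hB hγ hδ
    exact ⟨n₀, fun n hn hnn X μ _ => by simpa using hn₀ n hn hnn X μ⟩
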